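/- Throughout, $\mathcal N(0,v)$ is the centred normal law with variance $v\ge 0$ (a point mass at $0$ if $v=0$), and $W_1$ is the $1$-Wasserstein distance between the laws of real random variables, $W_1(Y,Z)=\inf\mathbb E|Y'-Z'|$, the infimum running over all couplings $(Y',Z')$ of the laws of $Y$ and $Z$. **(1) The network.** Let $C_b\ge 0$, $C_W>0$, let $L\ge 1$ and $n_0,\dots,n_{L+1}\ge 1$ be integers, let $x\in\mathbb R^{n_0}$, and let $\sigma:\mathbb R\to\mathbb R$ be Borel measurable (for instance Lipschitz). Let $b^{(\ell)}_j\sim\mathcal N(0,C_b)$ and $W^{(\ell)}_{j,k}$ ($1\le\ell\le L+1$, $1\le j\le n_\ell$, $1\le k\le n_{\ell-1}$) be mutually independent random variables, the $W^{(\ell)}_{j,k}$ being copies of a random variable $W$ with $\mathbb E[W]=0$ and $\mathbb E[W^2]=1$. Put $$z^{(1)}_j(x)=b^{(1)}_j+\sqrt{\tfrac{C_W}{n_0}}\sum_{k=1}^{n_0}W^{(1)}_{j,k}x_k,\qquad z^{(\ell)}_j(x)=b^{(\ell)}_j+\sqrt{\tfrac{C_W}{n_{\ell-1}}}\sum_{k=1}^{n_{\ell-1}}W^{(\ell)}_{j,k}\,\sigma\big(z^{(\ell-1)}_k(x)\big)\quad(2\le\ell\le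 L+1),$$ and define the limiting variances by $$K^{(2)}=C_b+C_W\,\mathbb E\big[\sigma(z^{(1)}_1(x))^2\big],\qquad K^{(\ell+1)}=C_b+C_W\,\mathbb E\big[\sigma(G^{(\ell)})^2\big],\quad G^{(\ell)}\sim\mathcal N(0,K^{(\ell)})\quad(2\le \ell\le L).$$ (These expectations are finite if $\sigma$ is Lipschitz; for other $\sigma$, an infinite expectation in this recursion is to be replaced by $0$.) Let $$Q_2^{(L)}(x)=\mathbb E\Big[\Big|\sum_{j=1}^{n_L}\frac{C_W}{n_L}\sigma^2\big(z^{(L)}_j(x)\big)-K^{(L+1)}+C_b\Big|^2\Big].$$ If $\mathbb E[W^4]<\infty$, $\mathbb E[|\sigma(z^{(L)}_1(x))|^4]<\infty$ and $K^{(L+1)}\neq 0$, then for $G^{(L+1)}_1(x)\sim\mathcal N(0,K^{(L+1)})$ $$W_1\big(z^{(L+1)}_1(x),G^{(L+1)}_1(x)\big)\le\frac{C_W}{\sqrt{n_L}\sqrt{K^{(L+1)}}}\,\mathbb E[W^4]^{3/4}\Big(\mathbb E\big[|\sigma(z^{(L)}_1(x))|^4\big]^{3/4}+1\Big)\Big(\frac{4\sqrt{C_W}}{\sqrt{K^{(L+1)}}}+\frac1{\sqrt{2\pi}}\Big)+\sqrt{\frac{2}{\pi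 K^{(L+1)}}}\,\sqrt{Q_2^{(L)}(x)} .$$ **(2) Normal approximation with a Gaussian bias.** Let $C_b\ge0$, $K>0$, $k\ge 0$, let $E$ be a Polish space and $f:E^k\to\mathbb R$ measurable. Let $X=(X_1,\dots,X_k)$ be a random vector with independent $E$-valued components, $X'$ an independent copy of $X$, and $b\sim\mathcal N(0,C_b)$ independent of $(X,X')$. Assume $\mathbb E[f(X)]=0$ and $\mathbb E[f(X)^4]<\infty$. For $A\subseteq[k]=\{1,\dots,k\}$ let $X^A$ be $X$ with the components $X_i$, $i\in A$, replaced by $X'_i$; for $y\in E^k$ let $\Delta_jf(y)=f(y)-f(y_1,\dots,y_{j-1},X'_j,y_{j+1},\dots,y_k)$, and let $$T=\frac12\sum_{A\subsetneq[k]}\frac{1}{\binom{k}{|A|}(k-|A|)}\sum_{j\notin A}\Delta_jf(X)\,\Delta_jf(X^A).$$ Put $V=b+f(X)$ and let $N\sim\mathcal N(0,K)$. Then $$W_1(V,N)\le\sqrt{\frac{2}{\pi K}}\;\mathbb E\Big[\mathbb E\big[K-C_b-T\,\big|\,V\big]^2\Big]^{1/2}+\frac1{2K}\sum_{j=1}^k\mathbb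 E\big[|\Delta_jf(X)|^3\big].$$ -/

import Mathlib

open MeasureTheory ProbabilityTheory
open scoped ENNReal NNReal

noncomputable section

/-- The `1`-Wasserstein distance between two laws on the real line: the infimum of the mean
transport cost over all couplings. It takes values in `[0, ∞]`. -/
def wassersteinOne (μ ν : Measure ℝ) : ℝ≥0∞ :=
  ⨅ (π : Measure (ℝ × ℝ)) (_ : π.fst = μ) (_ : π.snd = ν), ∫⁻ p, edist p.1 p.2 ∂π

section Network

variable {Ω : Type*} [MeasurableSpace Ω]

/-- Indices of the parameters of a network with `L` hidden layers and widths `n 0, …, n (L + 1)`.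
The weights (left) and the biases (right) leading from layer `ℓ` to layer `ℓ + 1` have
the index `ℓ = 0, …, L`. -/
abbrev ParamIndex (L : ℕ) (n : ℕ → ℕ) : Type :=
  (Σ ℓ : Fin (L + 1), Fin (n (ℓ + 1)) × Fin (n ℓ)) ⊕ (Σ ℓ : Fin (L + 1), Fin (n (ℓ + 1)))

/-- The family of all weights and biases of the network. -/
def params (L : ℕ) (n : ℕ → ℕ) (W : (ℓ : ℕ) → Fin (n (ℓ + 1)) → Fin (n ℓ) → Ω → ℝ)
    (b : (ℓ : ℕ) → Fin (n (ℓ + 1)) → Ω → ℝ) : ParamIndex L n → Ω → ℝ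
  | Sum.inl q => W q.1 q.2.1 q.2.2
  | Sum.inr q => b q.1 q.2

/-- The random initialization: the biases have law `N(0, Cb)`, the weights have the law `ν` of
a generic centred variable of unit variance, and all of them are mutually independent. -/
structure IsRandomInit (P : Measure Ω) (L : ℕ) (n : ℕ → ℕ) (Cb : ℝ) (ν : Measure ℝ)
    (W : (ℓ : ℕ) → Fin (n (ℓ + 1)) → Fin (n ℓ) → Ω → ℝ)
    (b : (ℓ : ℕ) → Fin (n (ℓ + 1)) → Ω → ℝ) : Prop where
  mean_zero : ∫ w, w ∂ν = 0
  var_one : ∫ w, w ^ 2 ∂ν = 1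
  measurable_weight : ∀ ℓ ≤ L, ∀ j k, Measurable (W ℓ j k)
  measurable_bias : ∀ ℓ ≤ L, ∀ j, Measurable (b ℓ j)
  law_weight : ∀ ℓ ≤ L, ∀ j k, P.map (W ℓ j k) = ν
  law_bias : ∀ ℓ ≤ L, ∀ j, P.map (b ℓ j) = gaussianReal 0 Cb.toNNReal
  indep : iIndepFun (params L n W b) P

/-- `preact σ CW n W b x ℓ j` is the `j`-th entry of the vector `z^(ℓ)(x)` for `ℓ ≥ 1`; the layer
`0` is the input itself. -/
def preact (σ : ℝ → ℝ) (CW : ℝ) (n : ℕ → ℕ)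
    (W : (ℓ : ℕ) → Fin (n (ℓ + 1)) → Fin (n ℓ) → Ω → ℝ)
    (b : (ℓ : ℕ) → Fin (n (ℓ + 1)) → Ω → ℝ) (x : Fin (n 0) → ℝ) :
    (ℓ : ℕ) → Fin (n ℓ) → Ω → ℝ
  | 0 => fun j _ => x j
  | 1 => fun j ω => b 0 j ω + √CW / √(n 0) * ∑ k, W 0 j k ω * x k
  | ℓ + 2 => fun j ω => b (ℓ + 1) j ω +
      √CW / √(n (ℓ + 1)) * ∑ k, W (ℓ + 1) j k ω * σ (preact σ CW n W b x (ℓ + 1) k ω)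

variable (P : Measure Ω) (σ : ℝ → ℝ) (Cb CW : ℝ) (n : ℕ → ℕ) [∀ ℓ, NeZero (n ℓ)]
  (W : (ℓ : ℕ) → Fin (n (ℓ + 1)) → Fin (n ℓ) → Ω → ℝ)
  (b : (ℓ : ℕ) → Fin (n (ℓ + 1)) → Ω → ℝ) (x : Fin (n 0) → ℝ)

/-- `limitVar P σ Cb CW n W b x ℓ` is the infinite-width variance `K^(ℓ)` for `ℓ ≥ 2` (the values
at `0` and `1` are placeholders):
`K^(2) = Cb + CW * E[σ(z_1^(1)(x))^2]` and `K^(ℓ+1) = Cb + CW * E[σ(G)^2]`, `G ∼ N(0, K^(ℓ))`. -/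
def limitVar : ℕ → ℝ
  | 0 => 0
  | 1 => 0
  | 2 => Cb + CW * ∫ ω, σ (preact σ CW n W b x 1 0 ω) ^ 2 ∂P
  | ℓ + 3 => Cb + CW * ∫ g, σ g ^ 2 ∂(gaussianReal 0 (limitVar (ℓ + 2)).toNNReal)

/-- `Q_p^(ℓ)(x)`. -/
def fluctuation (p ℓ : ℕ) : ℝ :=
  ∫ ω, |(∑ j, CW / (n ℓ) * σ (preact σ CW n W b x ℓ j ω) ^ 2)
      - limitVar P σ Cb CW n W b x (ℓ + 1) + Cb| ^ p ∂P

end Network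

section Resampling

variable {E : Type*} {k : ℕ}

/-- `x^A`: the coordinates in `A` are taken from `x'`, the other ones from `x`. -/
def resample (x x' : Fin k → E) (A : Finset (Fin k)) : Fin k → E :=
  fun i => if i ∈ A then x' i else x i

/-- `Δ_j f` at the point `y`, the `j`-th coordinate being replaced by that of `x'`. -/
def discreteDiff (f : (Fin k → E) → ℝ) (x' : Fin k → E) (j : Fin k) (y : Fin k → E) : ℝ :=
  f y - f (Function.update y j (x' j))

/-- The statistic `T`, a sum over the proper subsets `A` of the index set. -/
def steinT (f : (Fin k → E) → ℝ) (x x' : Fin k → E) : ℝ :=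
  1 / 2 * ∑ A ∈ (Finset.univ : Finset (Fin k)).ssubsets,
    1 / ((k.choose A.card : ℝ) * ((k : ℝ) - A.card)) *
      ∑ j ∈ Aᶜ, discreteDiff f x' j x * discreteDiff f x' j (resample x x' A)

end Resampling

end

/-! Both bounds come from Stein's method for `N(0, K)`. By Kantorovich duality on the line
(`wassersteinOne_le_of_forall_integral`) it suffices to compare expectations of functions `h` with
continuous derivative `φ`, `|φ| ≤ 1`. For such `h` the equation `K g' w - w g w = h w - c` has a
solution with `|g| ≤ 1`, `|g'| ≤ √(2/(Kπ))` and `|g''| ≤ 2/K` (`Stein.exists_sol`). Since `K g' - w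
g` has mean zero under `N(0, K)`, everything reduces to an upper bound on `E[K g'(V) - V g(V)]`
(`wassersteinOne_gaussianReal_le`). A Gaussian bias contributes exactly `E[b g(V)] = Cb E[g'(V)]`,
which replaces `K` by `K - Cb`; the rest of `V` must be integrated by parts approximately.

For `V = b + f(X)`, the increment from `f(X)` to `f(X')` is telescoped over all orders of
resampling. Exchanging `X_j` with `X'_j` while `b` stays fixed symmetrizes each term, and Taylor's
formula produces `E[T g'(V)]` up to third moments of `Δ_j f` (`exchange_integral_mul_ge`).
Conditioning on `V` and Cauchy–Schwarz finish.

The network bound does not go through the statistic `T`. The output is `b + ∑ a_j W_j`, where the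
random coefficients `a_j`, the rescaled activations of the last hidden layer, are independent of the
weights. A leave-one-out expansion (`IsLinearSetup.leaveOneOut_integral_mul_ge`) leaves `K - Cb - ∑
a_j² W_j²`. It splits into `K - Cb - ∑ a_j²`, whose second moment is the fluctuation `Q_2`, and `∑
a_j² (W_j² - 1)`, a sum of orthogonal terms. Equality in law of the neurons in a layer turns the
sums into single moments. -/

section

open Filter Topology Set

/-! ### Mills ratio inequalities for the standard normal law. -/

namespace Stein

/-- The standard normal density. -/
noncomputable def dens (w : ℝ) : ℝ := gaussianPDFReal 0 1 w

/-- The standard normal distribution function. -/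
noncomputable def Phi (w : ℝ) : ℝ := ∫ x in Iic w, dens x

theorem dens_eq (w : ℝ) : dens w = (√(2 * Real.pi))⁻¹ * Real.exp (-w ^ 2 / 2) := by
  simp [dens, gaussianPDFReal_def]

theorem dens_pos (w : ℝ) : 0 < dens w := gaussianPDFReal_pos 0 1 w one_ne_zero

theorem dens_neg (w : ℝ) : dens (-w) = dens w := by simp [dens_eq]

theorem hasDerivAt_dens (w : ℝ) : HasDerivAt dens (-w * dens w) w := by
  have h : HasDerivAt (fun w : ℝ => (√(2 * Real.pi))⁻¹ * Real.exp (-w ^ 2 / 2))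
      ((√(2 * Real.pi))⁻¹ * (Real.exp (-w ^ 2 / 2) * (-(2 * w) / 2))) w := by
    apply HasDerivAt.const_mul
    apply HasDerivAt.exp
    simpa using ((hasDerivAt_pow 2 w).neg.div_const 2)
  rw [show dens = fun w : ℝ => (√(2 * Real.pi))⁻¹ * Real.exp (-w ^ 2 / 2) from funext dens_eq]
  convert h using 1
  ring

theorem continuous_dens : Continuous dens :=
  continuous_iff_continuousAt.2 fun w => (hasDerivAt_dens w).continuousAt

theorem integrable_dens : Integrable dens := integrable_gaussianPDFReal 0 1

theorem integral_dens : ∫ x, dens x = 1 := integral_gaussianPDFReal_eq_one 0 one_ne_zero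

theorem dens_le (w : ℝ) : dens w ≤ dens 0 := by
  rw [dens_eq, dens_eq]
  gcongr ?_ * Real.exp ?_
  nlinarith [sq_nonneg w]

theorem dens_zero : 2 * dens 0 = √(2 / Real.pi) := by
  rw [dens_eq]
  have hp := Real.pi_pos
  rw [Real.sqrt_mul (by norm_num), Real.sqrt_div (by norm_num)]
  have h2 : √2 * √2 = (2 : ℝ) := Real.mul_self_sqrt (by norm_num)
  have : √(Real.pi) ≠ 0 := by positivity
  have : √(2 : ℝ) ≠ 0 := by positivity
  field_simp
  simp

theorem tendsto_dens_atTop : Tendsto dens atTop (𝓝 0) := by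
  rw [show dens = fun w : ℝ => (√(2 * Real.pi))⁻¹ * Real.exp (-w ^ 2 / 2) from funext dens_eq]
  rw [← mul_zero (√(2 * Real.pi))⁻¹]
  apply Tendsto.const_mul
  apply Real.tendsto_exp_atBot.comp
  have : Tendsto (fun w : ℝ => w ^ 2 / 2) atTop atTop :=
    (tendsto_pow_atTop two_ne_zero).atTop_div_const (by norm_num)
  exact (tendsto_neg_atTop_atBot.comp this).congr fun w => by simp [neg_div]

theorem Phi_neg (w : ℝ) : Phi (-w) = 1 - Phi w := by
  have h : ∫ x in Iic (-w), dens (-x) = ∫ x in Ioi w, dens x := by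
    simp
  simp only [dens_neg] at h
  have h2 := intervalIntegral.integral_Iic_add_Ioi (b := w) (f := dens) (μ := volume)
    integrable_dens.integrableOn integrable_dens.integrableOn
  rw [integral_dens] at h2
  unfold Phi
  linarith

theorem hasDerivAt_integral_Iic {f : ℝ → ℝ} (hf : Continuous f) (hi : ∀ w, IntegrableOn f (Iic w))
    (w : ℝ) : HasDerivAt (fun w => ∫ x in Iic w, f x) (f w) w := by
  have h : (fun w => ∫ x in Iic w, f x) = fun w => (∫ x in Iic 0, f x) + ∫ x in (0:ℝ)..w, f x := by
    ext w
    rw [← intervalIntegral.integral_Iic_sub_Iic (hi 0) (hi w)]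
    ring
  rw [h]
  exact (intervalIntegral.integral_hasDerivAt_right (hf.intervalIntegrable _ _)
    (hf.stronglyMeasurableAtFilter _ _) hf.continuousAt).const_add _

theorem hasDerivAt_Phi (w : ℝ) : HasDerivAt Phi (dens w) w :=
  hasDerivAt_integral_Iic continuous_dens (fun _ => integrable_dens.integrableOn) w

theorem continuous_Phi : Continuous Phi :=
  continuous_iff_continuousAt.2 fun w => (hasDerivAt_Phi w).continuousAt

theorem Phi_nonneg (w : ℝ) : 0 ≤ Phi w :=
  integral_nonneg fun x => (dens_pos x).le

theorem Phi_le_one (w : ℝ) : Phi w ≤ 1 := by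
  have := Phi_nonneg (-w)
  rw [Phi_neg] at this
  linarith

theorem tendsto_Phi_atBot : Tendsto Phi atBot (𝓝 0) :=
  tendsto_integral_Iic_zero tendsto_id

theorem tendsto_Psi_atTop : Tendsto (fun w => 1 - Phi w) atTop (𝓝 0) := by
  simp only [← Phi_neg]
  exact tendsto_Phi_atBot.comp tendsto_neg_atTop_atBot

/-- A function on a right half-line with nonpositive derivative and limit `0` is nonnegative. -/
theorem nonneg_of_deriv_nonpos {u u' : ℝ → ℝ} {a : ℝ} (hu : ∀ w ∈ Ioi a, HasDerivAt u (u' w) w)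
    (hu' : ∀ w ∈ Ioi a, u' w ≤ 0) (hlim : Tendsto u atTop (𝓝 0)) {w : ℝ} (hw : a < w) :
    0 ≤ u w := by
  have hanti : AntitoneOn u (Ioi a) := by
    apply antitoneOn_of_deriv_nonpos (convex_Ioi a)
    · exact fun x hx => (hu x hx).continuousAt.continuousWithinAt
    · rw [interior_Ioi]
      exact fun x hx => (hu x hx).differentiableAt.differentiableWithinAt
    · rw [interior_Ioi]
      intro x hx
      rw [(hu x hx).deriv]
      exact hu' x hx
  refine le_of_tendsto hlim ?_
  filter_upwards [eventually_ge_atTop w] with y hy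
  exact hanti hw (hw.trans_le hy) hy

/-- Upper Mills bound: for `w > 0` the difference `dens w / w - (1 - Phi w)` has derivative `-dens w
/ w²` and vanishes at infinity. -/
theorem mul_Psi_le_dens (w : ℝ) : w * (1 - Phi w) ≤ dens w := by
  rcases le_or_gt w 0 with hw | hw
  · nlinarith [dens_pos w, Phi_le_one w]
  have h := nonneg_of_deriv_nonpos (a := 0) (u := fun w => dens w / w - (1 - Phi w))
    (u' := fun w => -dens w / w ^ 2) ?_ ?_ ?_ hw
  · have h1 : 1 - Phi w ≤ dens w / w := by linarith
    rw [le_div_iff₀ hw] at h1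
    linarith
  · intro x hx
    have hx0 : x ≠ 0 := (mem_Ioi.1 hx).ne'
    have := ((hasDerivAt_dens x).div (hasDerivAt_id x) hx0).sub ((hasDerivAt_Phi x).const_sub 1)
    refine this.congr_deriv ?_
    simp only [id]
    field_simp
    ring
  · intro x _
    have := dens_pos x
    rw [neg_div]
    exact neg_nonpos.2 (by positivity)
  · have := (tendsto_dens_atTop.mul tendsto_inv_atTop_zero).sub tendsto_Psi_atTop
    simpa [div_eq_mul_inv] using this

theorem neg_mul_Phi_le_dens (w : ℝ) : -w * Phi w ≤ dens w := by
  have := mul_Psi_le_dens (-w)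
  rwa [Phi_neg, dens_neg, sub_sub_cancel] at this

theorem tendsto_mul_Psi_atTop : Tendsto (fun w => w * (1 - Phi w)) atTop (𝓝 0) := by
  refine squeeze_zero' ?_ (Eventually.of_forall mul_Psi_le_dens) tendsto_dens_atTop
  filter_upwards [eventually_ge_atTop 0] with w hw
  exact mul_nonneg hw (by linarith [Phi_le_one w])

/-- Lower Mills bound: after division by `1 + w²` the difference of the two sides has derivative `-2
dens w / (1 + w²)²` on the whole line and vanishes at `+∞`, so no sign of `w` is needed and any
half-line around `w` will do. -/
theorem mul_dens_le (w : ℝ) : w * dens w ≤ (1 + w ^ 2) * (1 - Phi w) := by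
  have h := nonneg_of_deriv_nonpos (a := w - 1)
    (u := fun w => (1 - Phi w) - w * dens w / (1 + w ^ 2))
    (u' := fun w => -(2 * dens w) / (1 + w ^ 2) ^ 2) ?_ ?_ ?_ (sub_one_lt w)
  · have h1 : w * dens w / (1 + w ^ 2) ≤ 1 - Phi w := by linarith
    rw [div_le_iff₀ (by positivity)] at h1
    linarith
  · intro x _
    have hx0 : 1 + x ^ 2 ≠ 0 := by positivity
    have := ((hasDerivAt_Phi x).const_sub 1).sub
      (((hasDerivAt_id x).mul (hasDerivAt_dens x)).div ((hasDerivAt_pow 2 x).const_add 1) hx0)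
    refine this.congr_deriv ?_
    simp only [id, Pi.mul_apply]
    field_simp
    ring
  · intro x _
    have := dens_pos x
    rw [neg_div]
    exact neg_nonpos.2 (by positivity)
  · have h0 : Tendsto (fun w => w * dens w / (1 + w ^ 2)) atTop (𝓝 0) := by
      refine squeeze_zero' (g := dens) ?_ ?_ tendsto_dens_atTop
      · filter_upwards [eventually_ge_atTop 0] with w hw
        have := dens_pos w
        positivity
      · refine Eventually.of_forall fun w => ?_
        rw [div_le_iff₀ (by positivity)]
        nlinarith [dens_pos w, mul_nonneg (dens_pos w).le (sq_nonneg (w - 1)),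
          mul_nonneg (dens_pos w).le (sq_nonneg w)]
    simpa using tendsto_Psi_atTop.sub h0

theorem neg_mul_dens_le (w : ℝ) : -w * dens w ≤ (1 + w ^ 2) * Phi w := by
  have := mul_dens_le (-w)
  rwa [Phi_neg, dens_neg, sub_sub_cancel, neg_sq] at this

theorem cdf_gap_le {w : ℝ} (hw : 0 ≤ w) : Phi w - (1 - Phi w) ≤ 2 * w * dens 0 := by
  have h : AntitoneOn (fun w => 2 * Phi w - 1 - 2 * w * dens 0) (Ici 0) := by
    have hd : ∀ x, HasDerivAt (fun w => 2 * Phi w - 1 - 2 * w * dens 0)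
        (2 * dens x - 2 * 1 * dens 0) x := fun x =>
      (((hasDerivAt_Phi x).const_mul 2).sub_const 1).sub
        (((hasDerivAt_id x).const_mul 2).mul_const (dens 0))
    apply antitoneOn_of_deriv_nonpos (convex_Ici 0)
    · exact fun x _ => (hd x).continuousAt.continuousWithinAt
    · exact fun x _ => (hd x).differentiableAt.differentiableWithinAt
    · intro x _
      rw [(hd x).deriv]
      linarith [dens_le x]
  have h0 := h self_mem_Ici (mem_Ici.2 hw) hw
  have h1 := Phi_neg 0
  simp only [neg_zero] at h1
  simp only [mul_zero, zero_mul] at h0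
  linarith

/-- The left side vanishes at `0` and its derivative `2 Phi w - 1 - 2 w dens 0` is nonpositive by
`cdf_gap_le`. This expression is the factor that fixes the sign of the derivative in
`derivBound_of_pos`. -/
theorem gap_mul_add_le {w : ℝ} (hw : 0 ≤ w) :
    w * (Phi w - (1 - Phi w)) + 2 * dens w - 2 * dens 0 - w ^ 2 * dens 0 ≤ 0 := by
  have h : AntitoneOn (fun w => w * (2 * Phi w - 1) + 2 * dens w - 2 * dens 0 - w ^ 2 * dens 0)
      (Ici 0) := by
    have hd : ∀ x, HasDerivAt
        (fun w => w * (2 * Phi w - 1) + 2 * dens w - 2 * dens 0 - w ^ 2 * dens 0)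
        ((1 * (2 * Phi x - 1) + x * (2 * dens x)) + 2 * (-x * dens x) - (2 * x) * dens 0) x := by
      intro x
      have := (((hasDerivAt_id x).mul (((hasDerivAt_Phi x).const_mul 2).sub_const 1)).add
        ((hasDerivAt_dens x).const_mul 2)).sub_const (2 * dens 0)
      refine (this.sub ((hasDerivAt_pow 2 x).mul_const (dens 0))).congr_deriv ?_
      simp
    apply antitoneOn_of_deriv_nonpos (convex_Ici 0)
    · exact fun x _ => (hd x).continuousAt.continuousWithinAt
    · exact fun x _ => (hd x).differentiableAt.differentiableWithinAt
    · intro x hx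
      rw [interior_Ici] at hx
      rw [(hd x).deriv]
      linarith [cdf_gap_le (le_of_lt (mem_Ioi.1 hx))]
  have h0 := h self_mem_Ici (mem_Ici.2 hw) hw
  simp only [zero_mul, ne_eq, OfNat.ofNat_ne_zero, not_false_eq_true, zero_pow] at h0
  have : w * (2 * Phi w - 1) = w * (Phi w - (1 - Phi w)) := by ring
  linarith

/-- Multiplying by `dens w / w²` isolates `Phi w * (1 - Phi w)`. The resulting difference `u`
vanishes at infinity and its derivative is `dens w / w³` times the expression of `gap_mul_add_le`,
so `u` decreases to `0`. -/
theorem derivBound_of_pos {w : ℝ} (hw : 0 < w) :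
    dens w + w * (Phi w - (1 - Phi w)) - w ^ 2 * Phi w * (1 - Phi w) / dens w ≤ dens 0 := by
  have h := nonneg_of_deriv_nonpos (a := 0)
    (u := fun w => Phi w * (1 - Phi w) -
      (dens w ^ 2 - dens w * dens 0 + w * dens w * (2 * Phi w - 1)) / w ^ 2)
    (u' := fun w => dens w * (w * (2 * Phi w - 1) + 2 * dens w - 2 * dens 0 - w ^ 2 * dens 0)
      / w ^ 3) ?_ ?_ ?_ hw
  · have hp := dens_pos w
    have h1 : (dens w ^ 2 - dens w * dens 0 + w * dens w * (2 * Phi w - 1)) / w ^ 2 ≤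
      Phi w * (1 - Phi w) := by linarith
    rw [div_le_iff₀ (by positivity)] at h1
    have h2 : dens w + w * (2 * Phi w - 1) - dens 0 ≤ w ^ 2 * Phi w * (1 - Phi w) / dens w := by
      rw [le_div_iff₀ hp]
      nlinarith
    linarith
  · intro x hx
    have hx0 : x ≠ 0 := (mem_Ioi.1 hx).ne'
    have hq : x ^ 2 ≠ 0 := pow_ne_zero 2 hx0
    have := ((hasDerivAt_Phi x).mul ((hasDerivAt_Phi x).const_sub 1)).sub
      (((((hasDerivAt_dens x).pow 2).sub ((hasDerivAt_dens x).mul_const (dens 0))).add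
        (((hasDerivAt_id x).mul (hasDerivAt_dens x)).mul
          (((hasDerivAt_Phi x).const_mul 2).sub_const 1))).div (hasDerivAt_pow 2 x) hq)
    refine this.congr_deriv ?_
    simp only [id, Pi.mul_apply, Pi.add_apply, Pi.sub_apply, Pi.pow_apply]
    field_simp
    ring
  · intro x hx
    have hx := mem_Ioi.1 hx
    have h1 := gap_mul_add_le hx.le
    have := dens_pos x
    apply div_nonpos_of_nonpos_of_nonneg _ (by positivity)
    apply mul_nonpos_of_nonneg_of_nonpos this.le
    have : x * (2 * Phi x - 1) = x * (Phi x - (1 - Phi x)) := by ring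
    linarith
  · have hPhi : Tendsto Phi atTop (𝓝 1) := by
      simpa using tendsto_Psi_atTop.const_sub 1
    have hi := tendsto_inv_atTop_zero (𝕜 := ℝ)
    have hd := tendsto_dens_atTop
    have h1 : Tendsto (fun w => Phi w * (1 - Phi w) - ((dens w * w⁻¹) ^ 2
        - dens w * dens 0 * (w⁻¹) ^ 2 + w⁻¹ * dens w * (2 * Phi w - 1))) atTop (𝓝 0) := by
      have := (hPhi.mul tendsto_Psi_atTop).sub (((((hd.mul hi).pow 2)).sub
        ((hd.mul_const (dens 0)).mul (hi.pow 2))).add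
        ((hi.mul hd).mul ((hPhi.const_mul 2).sub_const 1)))
      simpa using this
    refine h1.congr' ?_
    filter_upwards [eventually_gt_atTop 0] with x hx
    field_simp

/-- The left side is even in `w`, with equality at `0`. Twice this quantity is the worst case of
`|g'|` at `w`, so this is what gives the sharp constant `√(2/π)`. -/
theorem derivBound (w : ℝ) :
    dens w + w * (Phi w - (1 - Phi w)) - w ^ 2 * Phi w * (1 - Phi w) / dens w ≤ dens 0 := by
  rcases lt_trichotomy w 0 with hw | rfl | hw
  · have := derivBound_of_pos (neg_pos.2 hw)
    rw [Phi_neg, dens_neg, sub_sub_cancel] at this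
    convert this using 1
    ring
  · simp
  · exact derivBound_of_pos hw

end Stein

/-! ### The solution of Stein's equation and bounds on its derivatives. -/

namespace Stein

/-- This is the primitive of `Phi` that vanishes at `-∞`, hence the best bound for `lowerInt φ` when
`|φ| ≤ 1`. -/
theorem hasDerivAt_mul_Phi_add_dens (w : ℝ) :
    HasDerivAt (fun w => w * Phi w + dens w) (Phi w) w := by
  refine (((hasDerivAt_id w).mul (hasDerivAt_Phi w)).add (hasDerivAt_dens w)).congr_deriv ?_
  simp

theorem tendsto_mul_Phi_add_dens : Tendsto (fun w => w * Phi w + dens w) atBot (𝓝 0) := by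
  have h := (tendsto_dens_atTop.sub tendsto_mul_Psi_atTop).comp tendsto_neg_atBot_atTop
  rw [sub_zero] at h
  refine h.congr fun w => ?_
  simp only [Function.comp, dens_neg, Phi_neg]
  ring

theorem integrableOn_Phi (w : ℝ) : IntegrableOn Phi (Iic w) :=
  integrableOn_Iic_of_intervalIntegral_norm_bounded (a := id) (l := atBot) (w * Phi w + dens w) w
    (fun i => (continuous_Phi.integrableOn_Icc (a := i) (b := w)).mono_set Ioc_subset_Icc_self)
    tendsto_id <| Eventually.of_forall fun i => by
      simp only [Real.norm_of_nonneg (Phi_nonneg _)]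
      rw [intervalIntegral.integral_eq_sub_of_hasDerivAt
        (fun x _ => hasDerivAt_mul_Phi_add_dens x) (continuous_Phi.intervalIntegrable _ _)]
      simp only [id]
      linarith [neg_mul_Phi_le_dens i]

theorem integral_Phi (w : ℝ) : ∫ x in Iic w, Phi x = w * Phi w + dens w := by
  have := integral_Iic_of_hasDerivAt_of_tendsto' (a := w)
    (fun x _ => hasDerivAt_mul_Phi_add_dens x) (integrableOn_Phi w) tendsto_mul_Phi_add_dens
  simpa using this

section

variable {φ : ℝ → ℝ}

/-- The weighted lower integral of `φ` against the normal distribution function. -/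
noncomputable def lowerInt (φ : ℝ → ℝ) (w : ℝ) : ℝ := ∫ x in Iic w, φ x * Phi x

/-- The weighted upper integral of `φ` against the normal tail function. -/
noncomputable def upperInt (φ : ℝ → ℝ) (w : ℝ) : ℝ := lowerInt (fun x => φ (-x)) (-w)

theorem integrableOn_mul_Phi (hφ : Continuous φ) (hb : ∀ x, |φ x| ≤ 1) (w : ℝ) :
    IntegrableOn (fun x => φ x * Phi x) (Iic w) :=
  (integrableOn_Phi w).bdd_mul (c := 1) hφ.aestronglyMeasurable (Eventually.of_forall hb)

theorem hasDerivAt_lowerInt (hφ : Continuous φ) (hb : ∀ x, |φ x| ≤ 1) (w : ℝ) :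
    HasDerivAt (lowerInt φ) (φ w * Phi w) w :=
  hasDerivAt_integral_Iic (hφ.mul continuous_Phi) (integrableOn_mul_Phi hφ hb) w

theorem hasDerivAt_upperInt (hφ : Continuous φ) (hb : ∀ x, |φ x| ≤ 1) (w : ℝ) :
    HasDerivAt (upperInt φ) (-(φ w * (1 - Phi w))) w := by
  have h := (hasDerivAt_lowerInt (hφ.comp continuous_neg) (fun x => hb (-x)) (-w)).scomp w
    (hasDerivAt_neg w)
  refine h.congr_deriv ?_
  simp [Phi_neg]

theorem abs_lowerInt_le (hφ : Continuous φ) (hb : ∀ x, |φ x| ≤ 1) (w : ℝ) :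
    |lowerInt φ w| ≤ w * Phi w + dens w := by
  rw [← integral_Phi]
  refine (abs_integral_le_integral_abs).trans ?_
  apply integral_mono (integrableOn_mul_Phi hφ hb w).abs (integrableOn_Phi w)
  intro x
  simp only [abs_mul, abs_of_nonneg (Phi_nonneg x)]
  exact mul_le_of_le_one_left (Phi_nonneg x) (hb x)

theorem abs_upperInt_le (hφ : Continuous φ) (hb : ∀ x, |φ x| ≤ 1) (w : ℝ) :
    |upperInt φ w| ≤ dens w - w * (1 - Phi w) := by
  have := abs_lowerInt_le (hφ.comp continuous_neg) (fun x => hb (-x)) (-w)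
  rw [Phi_neg, dens_neg] at this
  unfold upperInt
  refine this.trans (le_of_eq ?_)
  ring

/-- The bounded solution `g` of `g' w - w * g w = h w - ∫ h dN(0,1)`, where `h' = φ`. -/
noncomputable def sol (φ : ℝ → ℝ) (w : ℝ) : ℝ :=
  -((1 - Phi w) * lowerInt φ w + Phi w * upperInt φ w) / dens w

/-- The derivative of `sol φ`. -/
noncomputable def sol' (φ : ℝ → ℝ) (w : ℝ) : ℝ :=
  w * sol φ w + (lowerInt φ w - upperInt φ w)

theorem hasDerivAt_sol (hφ : Continuous φ) (hb : ∀ x, |φ x| ≤ 1) (w : ℝ) :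
    HasDerivAt (sol φ) (sol' φ w) w := by
  have hp := dens_pos w
  have := ((((hasDerivAt_Phi w).const_sub 1).mul (hasDerivAt_lowerInt hφ hb w)).add
    ((hasDerivAt_Phi w).mul (hasDerivAt_upperInt hφ hb w))).neg.div (hasDerivAt_dens w) hp.ne'
  refine this.congr_deriv ?_
  simp only [Pi.add_apply, Pi.mul_apply, Pi.neg_apply, sol', sol]
  field_simp
  ring

/-- The weights `Phi` and `1 - Phi` add up to `1`. The difference is therefore a primitive of `φ`
and serves as the right side of Stein's equation. -/
theorem hasDerivAt_sub_upperInt (hφ : Continuous φ) (hb : ∀ x, |φ x| ≤ 1) (w : ℝ) :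
    HasDerivAt (fun w => lowerInt φ w - upperInt φ w) (φ w) w := by
  refine ((hasDerivAt_lowerInt hφ hb w).sub (hasDerivAt_upperInt hφ hb w)).congr_deriv ?_
  ring

theorem hasDerivAt_sol' (hφ : Continuous φ) (hb : ∀ x, |φ x| ≤ 1) (w : ℝ) :
    HasDerivAt (sol' φ) (sol φ w + w * sol' φ w + φ w) w := by
  refine (((hasDerivAt_id w).mul (hasDerivAt_sol hφ hb w)).add
    (hasDerivAt_sub_upperInt hφ hb w)).congr_deriv ?_
  simp

theorem abs_mul_add_mul_le {x y p q a c : ℝ} (hx : |x| ≤ p) (hy : |y| ≤ q) (ha : 0 ≤ a) (hc : 0 ≤ c) :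
    |x * a + y * c| ≤ p * a + q * c := by
  refine (abs_add_le _ _).trans ?_
  rw [abs_mul, abs_mul, abs_of_nonneg ha, abs_of_nonneg hc]
  gcongr

/-- With the extreme values of `lowerInt` and `upperInt` inserted, the numerator collapses to
exactly `dens w`. -/
theorem abs_sol_le (hφ : Continuous φ) (hb : ∀ x, |φ x| ≤ 1) (w : ℝ) : |sol φ w| ≤ 1 := by
  have hp := dens_pos w
  have h := abs_mul_add_mul_le (abs_lowerInt_le hφ hb w) (abs_upperInt_le hφ hb w)
    (sub_nonneg.2 (Phi_le_one w)) (Phi_nonneg w)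
  rw [sol, abs_div, abs_neg, abs_of_pos hp, div_le_one hp]
  calc _ = _ := by
        congr 1
        ring
    _ ≤ _ := h
    _ = _ := by ring

/-- `sol'` is linear in `lowerInt φ w` and `-upperInt φ w`, with coefficients that are nonnegative
by the upper Mills bounds. The extreme values then give twice the left side of `derivBound`. -/
theorem abs_sol'_le (hφ : Continuous φ) (hb : ∀ x, |φ x| ≤ 1) (w : ℝ) :
    |sol' φ w| ≤ √(2 / Real.pi) := by
  have hp := dens_pos w
  have h := abs_mul_add_mul_le (abs_lowerInt_le hφ hb w)
    ((abs_neg (upperInt φ w)).trans_le (abs_upperInt_le hφ hb w))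
    (a := 1 - w * (1 - Phi w) / dens w) (c := 1 + w * Phi w / dens w) ?_ ?_
  · rw [← dens_zero]
    calc |sol' φ w| = _ := by
          congr 1
          rw [sol', sol]
          field_simp
          ring
      _ ≤ _ := h
      _ = 2 * (dens w + w * (Phi w - (1 - Phi w)) - w ^ 2 * Phi w * (1 - Phi w) / dens w) := by
          field_simp
          ring
      _ ≤ _ := by linarith [derivBound w]
  · rw [sub_nonneg, div_le_one hp]
    exact mul_Psi_le_dens w
  · rw [← neg_le_iff_add_nonneg', le_div_iff₀ hp]
    linarith [neg_mul_Phi_le_dens w]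

/-- The part `g + w g'` is linear in the two integrals. The lower Mills bounds fix the signs of the
coefficients and the extreme values give exactly `1`; the term `φ` contributes the other `1`. -/
theorem abs_sol''_le (hφ : Continuous φ) (hb : ∀ x, |φ x| ≤ 1) (w : ℝ) :
    |sol φ w + w * sol' φ w + φ w| ≤ 2 := by
  have hp := dens_pos w
  have h := abs_mul_add_mul_le (abs_lowerInt_le hφ hb w) (abs_upperInt_le hφ hb w)
    (a := (1 + w ^ 2) * (1 - Phi w) / dens w - w) (c := (1 + w ^ 2) * Phi w / dens w + w) ?_ ?_
  · have h1 : |sol φ w + w * sol' φ w| ≤ 1 := by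
      rw [← abs_neg]
      calc |-(sol φ w + w * sol' φ w)| = _ := by
            congr 1
            rw [sol', sol]
            field_simp
            ring
        _ ≤ _ := h
        _ = 1 := by
            field_simp
            ring
    have := abs_add_le (sol φ w + w * sol' φ w) (φ w)
    linarith [hb w]
  · rw [sub_nonneg, le_div_iff₀ hp]
    exact mul_dens_le w
  · rw [← neg_le_iff_add_nonneg, le_div_iff₀ hp]
    exact neg_mul_dens_le w

theorem exists_sol_std (hφ : Continuous φ) (hb : ∀ x, |φ x| ≤ 1) :
    ∃ (g g' g'' : ℝ → ℝ) (c : ℝ), (∀ w, HasDerivAt g (g' w) w) ∧ (∀ w, HasDerivAt g' (g'' w) w) ∧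
      (∀ w, |g w| ≤ 1) ∧ (∀ w, |g' w| ≤ √(2 / Real.pi)) ∧ (∀ w, |g'' w| ≤ 2) ∧
      ∀ w, g' w - w * g w = (∫ t in (0:ℝ)..w, φ t) - c := by
  -- The constant only matches the base point `0` of the primitive. It need not be identified with a
  -- Gaussian mean, because it cancels when two laws are compared.
  refine ⟨sol φ, sol' φ, _, upperInt φ 0 - lowerInt φ 0, hasDerivAt_sol hφ hb,
    hasDerivAt_sol' hφ hb, abs_sol_le hφ hb, abs_sol'_le hφ hb, abs_sol''_le hφ hb, fun w => ?_⟩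
  rw [intervalIntegral.integral_eq_sub_of_hasDerivAt
    (fun x _ => hasDerivAt_sub_upperInt hφ hb x) (hφ.intervalIntegrable _ _), sol']
  ring

/-- Stein's equation for `N(0, K)` and a test function with continuous derivative `φ`. -/
theorem exists_sol {K : ℝ} (hK : 0 < K) (hφ : Continuous φ) (hb : ∀ x, |φ x| ≤ 1) :
    ∃ (g g' g'' : ℝ → ℝ) (c : ℝ), (∀ w, HasDerivAt g (g' w) w) ∧ (∀ w, HasDerivAt g' (g'' w) w) ∧
      (∀ w, |g w| ≤ 1) ∧ (∀ w, |g' w| ≤ √(2 / (K * Real.pi))) ∧ (∀ w, |g'' w| ≤ 2 / K) ∧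
      ∀ w, K * g' w - w * g w = (∫ t in (0:ℝ)..w, φ t) - c := by
  have hs : 0 < √K := Real.sqrt_pos.2 hK
  have hsK : √K * √K = K := Real.mul_self_sqrt hK.le
  -- Scaling: if `g` solves the standard equation for `φ (√K x)`, then `g (w / √K)` solves the one
  -- for `N(0, K)`; each derivative costs a factor `1 / √K`.
  obtain ⟨g, g', g'', c, hg, hg', h0, h1, h2, he⟩ := exists_sol_std
    (φ := fun x => φ (√K * x)) (by fun_prop) (fun x => hb _)
  have hlin : ∀ w, HasDerivAt (fun w => w / √K) (1 / √K) w := fun w =>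
    (hasDerivAt_id w).div_const _
  refine ⟨fun w => g (w / √K), fun w => g' (w / √K) / √K, fun w => g'' (w / √K) / K, √K * c,
    fun w => ?_, fun w => ?_, fun w => h0 _, fun w => ?_, fun w => ?_, fun w => ?_⟩
  · refine ((hg _).comp w (hlin w)).congr_deriv ?_
    ring
  · refine (((hg' _).comp w (hlin w)).div_const _).congr_deriv ?_
    field_simp
    linear_combination (g'' (w / √K)) * (-hsK)
  · rw [abs_div, abs_of_pos hs, div_le_iff₀ hs, ← Real.sqrt_mul (by positivity)]
    rw [div_mul_eq_mul_div, mul_comm K Real.pi, mul_div_mul_right _ _ hK.ne']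
    exact h1 _
  · rw [abs_div, abs_of_pos hK]
    gcongr
    exact h2 _
  · have h3 := he (w / √K)
    have h4 : √K * (∫ t in (0:ℝ)..(w / √K), φ (√K * t)) = ∫ t in (0:ℝ)..w, φ t := by
      rw [intervalIntegral.mul_integral_comp_mul_left]
      congr 1
      · simp
      · field_simp
    rw [← h4, ← mul_sub, ← h3]
    have h5 : w * √K * √K = w * K := by rw [mul_assoc, hsK]
    field_simp
    linear_combination -g' (w / √K) * hsK

end

end Stein

/-! ### Gaussian integration by parts. -/

namespace Stein

theorem integrable_comp_add_gaussianReal (v : ℝ≥0) (a : ℝ) {g : ℝ → ℝ} (hg : Continuous g)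
    {C : ℝ} (hC : ∀ x, |g x| ≤ C) : Integrable (fun x => g (x + a)) (gaussianReal 0 v) :=
  Integrable.of_bound (by fun_prop) C (Eventually.of_forall fun x => hC _)

theorem integrable_id_gaussianReal (v : ℝ≥0) : Integrable (fun x : ℝ => x) (gaussianReal 0 v) :=
  memLp_one_iff_integrable.1 (memLp_id_gaussianReal' 1 ENNReal.one_ne_top)

theorem integrable_mul_comp_add_gaussianReal (v : ℝ≥0) (a : ℝ) {g : ℝ → ℝ} (hg : Continuous g)
    {C : ℝ} (hC : ∀ x, |g x| ≤ C) : Integrable (fun x => x * g (x + a)) (gaussianReal 0 v) :=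
  (integrable_id_gaussianReal v).mul_bdd (c := C) (by fun_prop) (Eventually.of_forall fun x => hC _)

/-- Gaussian integration by parts. -/
theorem integral_mul_comp_add_gaussianReal (v : ℝ≥0) (a : ℝ) {g g' : ℝ → ℝ}
    (hg : ∀ x, HasDerivAt g (g' x) x) (hg' : Continuous g') {C C' : ℝ} (hC : ∀ x, |g x| ≤ C)
    (hC' : ∀ x, |g' x| ≤ C') :
    ∫ x, x * g (x + a) ∂gaussianReal 0 v = v * ∫ x, g' (x + a) ∂gaussianReal 0 v := by
  rcases eq_or_ne v 0 with rfl | hv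
  · simp
  have hgc : Continuous g := continuous_iff_continuousAt.2 fun w => (hg w).continuousAt
  have hv' : (v : ℝ) ≠ 0 := by exact_mod_cast hv
  have hpdf : ∀ x, HasDerivAt (gaussianPDFReal 0 v) (-(x / v) * gaussianPDFReal 0 v x) x := by
    intro x
    have h : HasDerivAt (fun x : ℝ => (√(2 * Real.pi * v))⁻¹ * Real.exp (-(x - 0) ^ 2 / (2 * v)))
        ((√(2 * Real.pi * v))⁻¹ * (Real.exp (-(x - 0) ^ 2 / (2 * v)) *
          (-(2 * (x - 0)) / (2 * v)))) x := by
      apply HasDerivAt.const_mul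
      apply HasDerivAt.exp
      simpa using ((hasDerivAt_pow 2 x).neg.div_const (2 * (v : ℝ)))
    rw [gaussianPDFReal_def]
    refine h.congr_deriv ?_
    field_simp
    ring
  have key : ∀ f : ℝ → ℝ, Integrable f (gaussianReal 0 v) →
      Integrable (fun x => gaussianPDFReal 0 v x * f x) := by
    intro f hf
    rw [gaussianReal_of_var_ne_zero 0 hv] at hf
    rw [integrable_withDensity_iff_integrable_smul₀' (by fun_prop)
      (Eventually.of_forall fun x => gaussianPDF_lt_top)] at hf
    simpa [toReal_gaussianPDF] using hf
  have i0 := integrable_comp_add_gaussianReal v a hgc hC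
  have i1 := integrable_comp_add_gaussianReal v a hg' hC'
  have i2 := integrable_mul_comp_add_gaussianReal v a hgc hC
  -- The derivative of density times `g (x + a)` has total integral zero; the term from the density
  -- is `-x / v`.
  have h := integral_eq_zero_of_hasDerivAt_of_integrable
    (f := fun x => gaussianPDFReal 0 v x * g (x + a))
    (f' := fun x => gaussianPDFReal 0 v x * (g' (x + a) - (v : ℝ)⁻¹ * (x * g (x + a)))) ?_ ?_ ?_
  · have h2 := integral_gaussianReal_eq_integral_smul (μ := 0) hv
      (f := fun x => g' (x + a) - (v : ℝ)⁻¹ * (x * g (x + a)))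
    simp only [smul_eq_mul] at h2
    rw [h, integral_sub i1 (i2.const_mul _), integral_const_mul, sub_eq_zero] at h2
    rw [h2, mul_inv_cancel_left₀ hv']
  · intro x
    refine ((hpdf x).mul ((hg (x + a)).comp_add_const x a)).congr_deriv ?_
    ring
  · exact key _ (i1.sub (i2.const_mul _))
  · exact key _ i0

end Stein

/-! ### The quantile coupling of two laws on the line. -/

section Quantile

/-- The quantile function of a law on the real line (`0` outside the open unit interval). -/
noncomputable def quantile (μ : Measure ℝ) (u : ℝ) : ℝ :=
  open Classical in if u ∈ Ioo (0 : ℝ) 1 then sInf {t | u ≤ cdf μ t} else 0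

variable (μ ν : Measure ℝ)

/-- Right continuity of the distribution function makes `{t | u ≤ cdf μ t}` closed on the left, so
it contains its infimum. -/
theorem quantile_le_iff {u : ℝ} (hu : u ∈ Ioo (0 : ℝ) 1) (t : ℝ) :
    quantile μ u ≤ t ↔ u ≤ cdf μ t := by
  rw [quantile, if_pos hu]
  have hbdd : BddBelow {t | u ≤ cdf μ t} := by
    obtain ⟨s, hs⟩ := ((tendsto_cdf_atBot μ).eventually_lt_const hu.1).exists
    refine ⟨s, fun t ht => ?_⟩
    by_contra! hlt
    exact absurd (monotone_cdf μ hlt.le) (not_le.2 (hs.trans_le ht))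
  have hne : {t | u ≤ cdf μ t}.Nonempty := by
    obtain ⟨s, hs⟩ := ((tendsto_cdf_atTop μ).eventually_const_lt hu.2).exists
    exact ⟨s, hs.le⟩
  refine ⟨fun h => ?_, fun h => csInf_le hbdd h⟩
  have hright : Tendsto (cdf μ) (𝓝[>] t) (𝓝 (cdf μ t)) :=
    ((cdf μ).right_continuous t).mono_left (nhdsWithin_mono t Ioi_subset_Ici_self)
  refine ge_of_tendsto hright ?_
  filter_upwards [self_mem_nhdsWithin] with s hs
  obtain ⟨r, hr, hrs⟩ := exists_lt_of_csInf_lt hne (h.trans_lt hs)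
  exact le_trans hr (monotone_cdf μ hrs.le)

theorem monotoneOn_quantile : MonotoneOn (quantile μ) (Ioo 0 1) := by
  intro u hu v hv huv
  rw [quantile_le_iff μ hu]
  exact huv.trans ((quantile_le_iff μ hv _).1 le_rfl)

theorem measurable_quantile : Measurable (quantile μ) := by
  refine measurable_of_Iic fun t => ?_
  have : quantile μ ⁻¹' Iic t =
      (Ioo 0 1 ∩ Iic (cdf μ t)) ∪ ((Ioo 0 1)ᶜ ∩ {_u | (0 : ℝ) ≤ t}) := by
    ext u
    by_cases hu : u ∈ Ioo (0 : ℝ) 1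
    · simp only [mem_preimage, mem_Iic, quantile_le_iff μ hu, mem_union, mem_inter_iff, hu,
        true_and, mem_compl_iff, not_true_eq_false, false_and, or_false]
    · simp only [mem_preimage, mem_Iic, mem_union, mem_inter_iff, hu, false_and, mem_compl_iff,
        not_false_eq_true, true_and, false_or, quantile, if_false, mem_ofPred_eq]
  rw [this]
  exact (measurableSet_Ioo.inter measurableSet_Iic).union
    (measurableSet_Ioo.compl.inter (MeasurableSet.const _))

/-- The uniform law on the open unit interval. -/
noncomputable def uniformLaw : Measure ℝ := volume.restrict (Ioo 0 1)

instance : IsProbabilityMeasure uniformLaw := ⟨by simp [uniformLaw]⟩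

/-- The signed indicator of the interval between `a` and `b`. -/
noncomputable def signedInd (a b t : ℝ) : ℝ :=
  (Ioc b a).indicator 1 t - (Ioc a b).indicator 1 t

/-- Increments of a primitive of `φ` become integrals against a kernel, to which Fubini's theorem
applies once `a` and `b` are quantiles. -/
theorem integral_mul_signedInd {φ : ℝ → ℝ} (a b : ℝ) (hφ : Continuous φ) :
    ∫ t, φ t * signedInd a b t = ∫ t in b..a, φ t := by
  have h : ∀ c d : ℝ, Integrable (fun t => φ t * (Ioc c d).indicator 1 t) := by
    intro c d
    have := (hφ.integrableOn_Icc (a := c) (b := d) (μ := volume)).mono_set Ioc_subset_Icc_self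
    rw [← integrable_indicator_iff measurableSet_Ioc] at this
    refine this.congr (Eventually.of_forall fun t => ?_)
    by_cases ht : t ∈ Ioc c d <;> simp [ht]
  have h2 : ∀ c d : ℝ, ∫ t, φ t * (Ioc c d).indicator 1 t = ∫ t in Ioc c d, φ t := by
    intro c d
    rw [← integral_indicator measurableSet_Ioc]
    congr with t
    by_cases ht : t ∈ Ioc c d <;> simp [ht]
  simp only [signedInd, mul_sub]
  rw [integral_sub (h _ _) (h _ _), h2, h2, intervalIntegral.intervalIntegral_eq_integral_uIoc]
  rcases le_total b a with hab | hab
  · simp [hab]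
  · rcases hab.eq_or_lt with rfl | hlt
    · simp
    · simp [hab, not_le.2 hlt]

theorem abs_signedInd (a b t : ℝ) : |signedInd a b t| = (uIoc a b).indicator 1 t := by
  rcases le_total b a with hab | hab
  · rw [signedInd, uIoc_of_ge hab, Ioc_eq_empty (not_lt.2 hab)]
    by_cases ht : t ∈ Ioc b a <;> simp [ht]
  · rw [signedInd, uIoc_of_le hab, Ioc_eq_empty (not_lt.2 hab)]
    by_cases ht : t ∈ Ioc a b <;> simp [ht]

theorem integral_abs_signedInd (a b : ℝ) : ∫ t, |signedInd a b t| = |a - b| := by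
  simp only [abs_signedInd]
  rw [integral_indicator_one measurableSet_uIoc]
  simp [Measure.real, abs_sub_comm]

/-- Opposite signs at `u` and `v` would put `t` between the quantiles in opposite orders, against
the monotonicity of one of the two quantile functions. This absence of cancellation makes the
quantile coupling match the dual bound. -/
theorem signedInd_nonneg_or_nonpos (t : ℝ) :
    (∀ u ∈ Ioo (0 : ℝ) 1, 0 ≤ signedInd (quantile μ u) (quantile ν u) t) ∨
      ∀ u ∈ Ioo (0 : ℝ) 1, signedInd (quantile μ u) (quantile ν u) t ≤ 0 := by
  by_contra! h
  obtain ⟨⟨u, hu, h1⟩, v, hv, h2⟩ := h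
  have e1 : t ∈ Ioc (quantile μ u) (quantile ν u) := by
    by_contra hc
    rw [signedInd, indicator_of_notMem hc, sub_zero] at h1
    exact absurd h1 (not_lt.2 (indicator_nonneg (by simp) _))
  have e2 : t ∈ Ioc (quantile ν v) (quantile μ v) := by
    by_contra hc
    rw [signedInd, indicator_of_notMem hc, zero_sub] at h2
    exact absurd h2 (not_lt.2 (neg_nonpos.2 (indicator_nonneg (by simp) _)))
  rcases le_total u v with huv | huv
  · exact absurd (e1.2.trans (monotoneOn_quantile ν hu hv huv)) (not_le.2 e2.1)
  · exact absurd (e2.2.trans (monotoneOn_quantile μ hv hu huv)) (not_le.2 e1.1)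

variable [IsProbabilityMeasure μ] [IsProbabilityMeasure ν]

theorem map_quantile : uniformLaw.map (quantile μ) = μ := by
  have := Measure.isProbabilityMeasure_map (μ := uniformLaw) (measurable_quantile μ).aemeasurable
  refine Measure.ext_of_Iic _ _ fun t => ?_
  rw [Measure.map_apply (measurable_quantile μ) measurableSet_Iic, uniformLaw,
    Measure.restrict_apply (measurable_quantile μ measurableSet_Iic), ← ofReal_cdf]
  have h : quantile μ ⁻¹' Iic t ∩ Ioo 0 1 = Ioo 0 1 ∩ Iic (cdf μ t) := by
    ext u
    simp only [mem_inter_iff, mem_preimage, mem_Iic]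
    constructor
    · rintro ⟨h, hu⟩
      exact ⟨hu, (quantile_le_iff μ hu t).1 h⟩
    · rintro ⟨hu, h⟩
      exact ⟨(quantile_le_iff μ hu t).2 h, hu⟩
  rw [h]
  apply le_antisymm
  · have hsub : Ioo 0 1 ∩ Iic (cdf μ t) ⊆ Ioc 0 (cdf μ t) := fun u hu => ⟨hu.1.1, hu.2⟩
    calc _ ≤ volume (Ioc 0 (cdf μ t)) := measure_mono hsub
      _ = _ := by simp
  · have hsub : Ioo 0 (cdf μ t) ⊆ Ioo 0 1 ∩ Iic (cdf μ t) := fun u hu =>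
      ⟨⟨hu.1, hu.2.trans_le (cdf_le_one μ t)⟩, hu.2.le⟩
    calc ENNReal.ofReal (cdf μ t) = volume (Ioo 0 (cdf μ t)) := by simp
      _ ≤ _ := measure_mono hsub

theorem wassersteinOne_le_lintegral_quantile :
    wassersteinOne μ ν ≤ ∫⁻ u, edist (quantile μ u) (quantile ν u) ∂uniformLaw := by
  have hm : Measurable fun u => (quantile μ u, quantile ν u) :=
    (measurable_quantile μ).prodMk (measurable_quantile ν)
  refine (iInf_le _ (uniformLaw.map fun u => (quantile μ u, quantile ν u))).trans ?_
  refine (iInf_le _ ?_).trans ((iInf_le _ ?_).trans ?_)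
  · rw [Measure.fst, Measure.map_map measurable_fst hm]
    exact map_quantile μ
  · rw [Measure.snd, Measure.map_map measurable_snd hm]
    exact map_quantile ν
  · rw [lintegral_map (by fun_prop) hm]

end Quantile

/-! ### Kantorovich duality on the real line. -/

section Duality

/-- Approximation of the sign of an integrable function by continuous test functions. -/
theorem exists_continuous_integral_mul_ge {κ : ℝ → ℝ} (hκ : Integrable κ) (hm : Measurable κ)
    {ε : ℝ} (hε : 0 < ε) :
    ∃ φ : ℝ → ℝ, Continuous φ ∧ (∀ x, |φ x| ≤ 1) ∧ ∫ t, |κ t| ≤ (∫ t, φ t * κ t) + ε := by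
  -- The measure `|κ| dt` is finite, so bounded continuous functions approximate the sign of `κ` in
  -- its `L¹`.
  let ρ : Measure ℝ := volume.withDensity fun t => ‖κ t‖ₑ
  have hfin : IsFiniteMeasure ρ := isFiniteMeasure_withDensity hκ.2.ne
  have hs : Measurable fun t => (SignType.sign (κ t) : ℝ) := by
    have : Measurable fun x : ℝ => (SignType.sign x : ℝ) := by
      have h1 : (fun x : ℝ => (SignType.sign x : ℝ)) =
          fun x => if 0 < x then 1 else if x < 0 then -1 else 0 := by
        ext x
        rw [sign_apply]
        split_ifs <;> simp
      rw [h1]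
      exact Measurable.ite measurableSet_Ioi measurable_const
        (Measurable.ite measurableSet_Iio measurable_const measurable_const)
    exact this.comp hm
  have hs1 : ∀ t, |(SignType.sign (κ t) : ℝ)| ≤ 1 := by
    intro t
    rcases lt_trichotomy (κ t) 0 with h | h | h <;> simp [h]
  have hsi : Integrable (fun t => (SignType.sign (κ t) : ℝ)) ρ :=
    Integrable.of_bound hs.aestronglyMeasurable 1 (Eventually.of_forall hs1)
  obtain ⟨g, hg, hgi⟩ := hsi.exists_boundedContinuous_integral_sub_le hε
  -- Truncation to `[-1, 1]` brings `g` no farther from a sign `±1`; where `κ = 0` the value is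
  -- irrelevant.
  refine ⟨fun t => max (-1) (min 1 (g t)), by fun_prop, fun t => ?_, ?_⟩
  · rw [abs_le]
    exact ⟨le_max_left _ _, max_le (by norm_num) (min_le_left _ _)⟩
  have hint : ∫ t, ‖(SignType.sign (κ t) : ℝ) - g t‖ ∂ρ =
      ∫ t, |κ t| * |(SignType.sign (κ t) : ℝ) - g t| := by
    rw [integral_withDensity_eq_integral_toReal_smul (by fun_prop)
      (Eventually.of_forall fun x => enorm_lt_top)]
    simp
  have hint2 : Integrable fun t => |κ t| * |(SignType.sign (κ t) : ℝ) - g t| := by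
    have := (hsi.sub hgi).norm
    rw [integrable_withDensity_iff_integrable_smul₀' (by fun_prop)
      (Eventually.of_forall fun x => enorm_lt_top)] at this
    simpa using this
  have hφi : Integrable fun t => max (-1) (min 1 (g t)) * κ t := by
    refine hκ.bdd_mul (c := 1) (by fun_prop) (Eventually.of_forall fun t => ?_)
    rw [Real.norm_eq_abs, abs_le]
    exact ⟨le_max_left _ _, max_le (by norm_num) (min_le_left _ _)⟩
  rw [hint] at hg
  have hle : ∫ t, |κ t| ≤
      ∫ t, (max (-1) (min 1 (g t)) * κ t + |κ t| * |(SignType.sign (κ t) : ℝ) - g t|) := by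
    refine integral_mono hκ.abs (hφi.add hint2) fun t => ?_
    simp only
    rcases lt_trichotomy (κ t) 0 with h | h | h
    · simp only [h, sign_neg, SignType.coe_neg, SignType.coe_one, abs_of_neg h]
      rcases le_total (g t) (-1) with h1 | h1
      · rw [min_eq_right (by linarith), max_eq_left h1]
        nlinarith [abs_nonneg (-1 - g t)]
      · rw [max_eq_right (le_min (by norm_num) h1)]
        nlinarith [neg_abs_le (-1 - g t), min_le_right 1 (g t)]
    · simp [h]
    · simp only [h, sign_pos, SignType.coe_one, abs_of_pos h]
      rcases le_total 1 (g t) with h1 | h1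
      · rw [min_eq_left h1, max_eq_right (by norm_num)]
        nlinarith [abs_nonneg (1 - g t)]
      · rw [min_eq_right h1]
        nlinarith [le_abs_self (1 - g t), le_max_right (-1) (g t)]
  rw [integral_add hφi hint2] at hle
  linarith

variable {μ ν : Measure ℝ}

theorem measurable_signedInd_quantile : Measurable fun p : ℝ × ℝ =>
    signedInd (quantile μ p.1) (quantile ν p.1) p.2 := by
  have h1 : ∀ μ ν : Measure ℝ, MeasurableSet {p : ℝ × ℝ | p.2 ∈ Ioc (quantile μ p.1) (quantile ν p.1)} :=
    fun μ ν => (measurableSet_lt ((measurable_quantile μ).comp measurable_fst) measurable_snd).inter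
      (measurableSet_le measurable_snd ((measurable_quantile ν).comp measurable_fst))
  have h2 : ∀ μ ν : Measure ℝ, Measurable fun p : ℝ × ℝ =>
      (Ioc (quantile μ p.1) (quantile ν p.1)).indicator (1 : ℝ → ℝ) p.2 := fun μ ν =>
    (measurable_const (a := (1 : ℝ))).indicator (h1 μ ν)
  exact (h2 ν μ).sub (h2 μ ν)

variable [IsProbabilityMeasure μ] [IsProbabilityMeasure ν]

/-- Kantorovich duality on the real line, for test functions with continuous derivative. -/
theorem wassersteinOne_le_of_forall_integral (hμ : Integrable (fun x : ℝ => x) μ)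
    (hν : Integrable (fun x : ℝ => x) ν) {C : ℝ}
    (h : ∀ φ : ℝ → ℝ, Continuous φ → (∀ x, |φ x| ≤ 1) →
      (∫ x, (∫ t in (0:ℝ)..x, φ t) ∂μ) - ∫ x, (∫ t in (0:ℝ)..x, φ t) ∂ν ≤ C) :
    wassersteinOne μ ν ≤ ENNReal.ofReal C := by
  have transfer : ∀ (μ : Measure ℝ) [IsProbabilityMeasure μ] {f : ℝ → ℝ}, Integrable f μ →
      Integrable (fun u => f (quantile μ u)) uniformLaw := by
    intro μ _ f hf
    rw [← map_quantile μ] at hf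
    exact hf.comp_measurable (measurable_quantile μ)
  have hqμ := transfer μ hμ
  have hqν := transfer ν hν
  have hmeas := measurable_signedInd_quantile (μ := μ) (ν := ν)
  have hk : Integrable (fun p : ℝ × ℝ => signedInd (quantile μ p.1) (quantile ν p.1) p.2)
      (uniformLaw.prod volume) := by
    rw [integrable_prod_iff hmeas.aestronglyMeasurable]
    constructor
    · refine Eventually.of_forall fun u => ?_
      have hi : ∀ c d : ℝ, Integrable ((Ioc c d).indicator (1 : ℝ → ℝ)) := fun c d =>
        (integrable_indicator_iff measurableSet_Ioc).2
          (integrableOn_const (by simp) (C := (1 : ℝ)))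
      exact (hi (quantile ν u) (quantile μ u)).sub (hi (quantile μ u) (quantile ν u))
    · simp only [Real.norm_eq_abs, integral_abs_signedInd]
      exact (hqμ.sub hqν).abs
  -- Almost everywhere, `κ` is the difference `cdf ν - cdf μ`.
  set κ : ℝ → ℝ := fun t => ∫ u, signedInd (quantile μ u) (quantile ν u) t ∂uniformLaw with hκdef
  have hκ : Integrable κ := hk.integral_prod_right
  have hκm : Measurable κ :=
    (StronglyMeasurable.integral_prod_left (μ := uniformLaw)
      (f := fun u t => signedInd (quantile μ u) (quantile ν u) t) hmeas.stronglyMeasurable).measurable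
  -- For fixed `t` the kernel has one sign in `u`, so the absolute value may be taken outside the
  -- integral over `u`.
  have hcost : ∫ u, |quantile μ u - quantile ν u| ∂uniformLaw = ∫ t, |κ t| := by
    calc _ = ∫ u, (∫ t, |signedInd (quantile μ u) (quantile ν u) t|) ∂uniformLaw := by
          simp only [integral_abs_signedInd]
      _ = ∫ t, ∫ u, |signedInd (quantile μ u) (quantile ν u) t| ∂uniformLaw :=
          integral_integral_swap hk.abs
      _ = _ := by
          congr with t
          have hae : ∀ᵐ u ∂uniformLaw, u ∈ Ioo (0 : ℝ) 1 := ae_restrict_mem measurableSet_Ioo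
          rcases signedInd_nonneg_or_nonpos μ ν t with ht | ht
          · rw [hκdef]
            simp only
            rw [abs_of_nonneg (integral_nonneg_of_ae (hae.mono ht))]
            exact integral_congr_ae (hae.mono fun u hu => abs_of_nonneg (ht u hu))
          · rw [hκdef]
            simp only
            rw [abs_of_nonpos (integral_nonpos_of_ae (hae.mono ht)), ← integral_neg]
            exact integral_congr_ae (hae.mono fun u hu => abs_of_nonpos (ht u hu))
  have htest : ∀ φ : ℝ → ℝ, Continuous φ → (∀ x, |φ x| ≤ 1) → ∫ t, φ t * κ t ≤ C := by
    intro φ hφ hb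
    refine le_trans (le_of_eq ?_) (h φ hφ hb)
    have hprim : ∀ x, |∫ t in (0:ℝ)..x, φ t| ≤ |x| := by
      intro x
      simpa using intervalIntegral.norm_integral_le_of_norm_le_const (a := 0) (b := x) (f := φ)
        (C := 1) (fun t _ => hb t)
    have hpc : Continuous fun x => ∫ t in (0:ℝ)..x, φ t :=
      intervalIntegral.continuous_primitive (fun a b => hφ.intervalIntegrable a b) 0
    have hpμ : Integrable (fun x => ∫ t in (0:ℝ)..x, φ t) μ :=
      hμ.mono hpc.aestronglyMeasurable (Eventually.of_forall hprim)
    have hpν : Integrable (fun x => ∫ t in (0:ℝ)..x, φ t) ν :=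
      hν.mono hpc.aestronglyMeasurable (Eventually.of_forall hprim)
    have hφk : Integrable (fun p : ℝ × ℝ =>
        φ p.2 * signedInd (quantile μ p.1) (quantile ν p.1) p.2) (uniformLaw.prod volume) :=
      hk.bdd_mul (c := 1) (by fun_prop) (Eventually.of_forall fun p => hb _)
    have hmap : ∀ (μ : Measure ℝ) [IsProbabilityMeasure μ], ∫ x, (∫ t in (0:ℝ)..x, φ t) ∂μ =
        ∫ u, (∫ t in (0:ℝ)..quantile μ u, φ t) ∂uniformLaw := by
      intro μ _
      nth_rw 1 [← map_quantile μ]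
      exact integral_map (measurable_quantile μ).aemeasurable hpc.aestronglyMeasurable
    calc ∫ t, φ t * κ t
        = ∫ t, ∫ u, φ t * signedInd (quantile μ u) (quantile ν u) t ∂uniformLaw := by
          simp only [integral_const_mul, hκdef]
      _ = ∫ u, (∫ t, φ t * signedInd (quantile μ u) (quantile ν u) t) ∂uniformLaw :=
          (integral_integral_swap hφk).symm
      _ = ∫ u, ((∫ t in (0:ℝ)..quantile μ u, φ t) - ∫ t in (0:ℝ)..quantile ν u, φ t)
            ∂uniformLaw := by
          congr with u
          rw [integral_mul_signedInd _ _ hφ, intervalIntegral.integral_interval_sub_left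
            (hφ.intervalIntegrable _ _) (hφ.intervalIntegrable _ _)]
      _ = _ := by
          rw [integral_sub (transfer μ hpμ) (transfer ν hpν), hmap μ, hmap ν]
  have hC : ∫ t, |κ t| ≤ C := by
    refine le_of_forall_pos_le_add fun ε hε => ?_
    obtain ⟨φ, hφ, hb, hle⟩ := exists_continuous_integral_mul_ge hκ hκm hε
    exact hle.trans (by linarith [htest φ hφ hb])
  refine (wassersteinOne_le_lintegral_quantile μ ν).trans ?_
  rw [← hcost] at hC
  refine le_trans (le_of_eq ?_) (ENNReal.ofReal_le_ofReal hC)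
  rw [ofReal_integral_eq_lintegral_ofReal
    (f := fun u => |quantile μ u - quantile ν u|) (hqμ.sub hqν).abs
    (Eventually.of_forall fun u => abs_nonneg _)]
  simp only [edist_dist, Real.dist_eq]

end Duality

/-! ### Stein's method for `N(0, K)`. -/

/-- The class of functions that contains the solutions of Stein's equation for `N(0, K)`. -/
structure IsSteinFun (K : ℝ) (g g' g'' : ℝ → ℝ) : Prop where
  hasDerivAt : ∀ w, HasDerivAt g (g' w) w
  hasDerivAt' : ∀ w, HasDerivAt g' (g'' w) w
  abs_le : ∀ w, |g w| ≤ 1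
  abs_deriv_le : ∀ w, |g' w| ≤ √(2 / (K * Real.pi))
  abs_deriv2_le : ∀ w, |g'' w| ≤ 2 / K

namespace IsSteinFun

variable {K : ℝ} {g g' g'' : ℝ → ℝ}

theorem continuous (h : IsSteinFun K g g' g'') : Continuous g :=
  continuous_iff_continuousAt.2 fun w => (h.hasDerivAt w).continuousAt

theorem continuous_deriv (h : IsSteinFun K g g' g'') : Continuous g' :=
  continuous_iff_continuousAt.2 fun w => (h.hasDerivAt' w).continuousAt

/-- The constant is half the bound `2 / K` on `g''`. No integrability of `g''` is assumed, so `g'`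
is first shown Lipschitz by the mean value inequality, and only `g'` is integrated along the
segment. -/
theorem abs_taylor_le (h : IsSteinFun K g g' g'') (y z : ℝ) :
    |g y - g z - g' y * (y - z)| ≤ 1 / K * (y - z) ^ 2 := by
  set d := y - z with hd
  have hlip : ∀ s ∈ Icc (0 : ℝ) 1, ‖-d * g' (y - s * d) + d * g' y‖ ≤ 2 / K * d ^ 2 * s := by
    intro s hs
    have h1 : ‖g' (y - s * d) - g' y‖ ≤ 2 / K * ‖(y - s * d) - y‖ :=
      convex_univ.norm_image_sub_le_of_norm_hasDerivWithin_le (f := g') (f' := g'')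
        (fun x _ => (h.hasDerivAt' x).hasDerivWithinAt) (fun x _ => h.abs_deriv2_le x)
        (mem_univ _) (mem_univ _)
    have h2 : ‖(y - s * d) - y‖ = s * |d| := by
      rw [sub_sub_cancel_left, norm_neg, Real.norm_eq_abs, abs_mul, abs_of_nonneg hs.1]
    rw [h2] at h1
    calc ‖-d * g' (y - s * d) + d * g' y‖ = |d| * ‖g' (y - s * d) - g' y‖ := by
          rw [Real.norm_eq_abs, Real.norm_eq_abs, ← abs_mul, ← abs_neg]
          congr 1
          ring
      _ ≤ |d| * (2 / K * (s * |d|)) := by gcongr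
      _ = 2 / K * (|d| * |d|) * s := by ring
      _ = _ := by rw [abs_mul_abs_self, pow_two]
  have hc := h.continuous_deriv
  have hftc : ∫ s in (0:ℝ)..1, (-d * g' (y - s * d) + d * g' y) =
      g z - g y + g' y * d := by
    rw [intervalIntegral.integral_add ((by fun_prop : Continuous _).intervalIntegrable _ _)
      ((by fun_prop : Continuous _).intervalIntegrable _ _),
      intervalIntegral.integral_eq_sub_of_hasDerivAt (f := fun s => g (y - s * d)) (fun s _ => ?_)
      ((by fun_prop : Continuous _).intervalIntegrable _ _)]
    · simp [hd]
      ring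
    · have h3 : HasDerivAt (fun s : ℝ => y - s * d) (-d) s := by
        simpa using ((hasDerivAt_id s).mul_const d).const_sub y
      refine ((h.hasDerivAt _).comp s h3).congr_deriv ?_
      ring
  have hb := intervalIntegral.norm_integral_le_of_norm_le (μ := volume) zero_le_one
    (Eventually.of_forall fun s hs => hlip s (Ioc_subset_Icc_self hs))
    ((by fun_prop : Continuous fun s : ℝ => 2 / K * d ^ 2 * s).intervalIntegrable 0 1)
  rw [hftc, intervalIntegral.integral_const_mul, integral_id, Real.norm_eq_abs, ← abs_neg] at hb
  convert hb using 1
  · congr 1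
    ring
  · ring

end IsSteinFun

section SteinMethod

variable {Ω : Type*} [MeasurableSpace Ω] {P : Measure Ω} [IsProbabilityMeasure P]

/-- Stein's method for the `1`-Wasserstein distance to a centred normal law. -/
theorem wassersteinOne_gaussianReal_le {V : Ω → ℝ} (hV : Measurable V) (hVi : Integrable V P)
    {K C : ℝ} (hK : 0 < K)
    (h : ∀ g g' g'', IsSteinFun K g g' g'' → ∫ ω, (K * g' (V ω) - V ω * g (V ω)) ∂P ≤ C) :
    wassersteinOne (P.map V) (gaussianReal 0 K.toNNReal) ≤ ENNReal.ofReal C := by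
  have := Measure.isProbabilityMeasure_map (μ := P) hV.aemeasurable
  have hid : Integrable (fun x : ℝ => x) (P.map V) :=
    (integrable_map_measure (by fun_prop) hV.aemeasurable).2 hVi
  refine wassersteinOne_le_of_forall_integral hid (Stein.integrable_id_gaussianReal _) ?_
  intro φ hφ hb
  obtain ⟨g, g', g'', c, h1, h2, h3, h4, h5, h6⟩ := Stein.exists_sol hK hφ hb
  have hS : IsSteinFun K g g' g'' := ⟨h1, h2, h3, h4, h5⟩
  have hgc := hS.continuous
  have hgc' := hS.continuous_deriv
  have hint : ∀ μ : Measure ℝ, IsProbabilityMeasure μ → Integrable (fun x : ℝ => x) μ →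
      Integrable (fun x => K * g' x - x * g x) μ := by
    intro μ _ hμ
    refine Integrable.sub ?_ ?_
    · exact (Integrable.of_bound hgc'.aestronglyMeasurable _ (Eventually.of_forall h4)).const_mul K
    · exact hμ.mul_bdd (c := 1) hgc.aestronglyMeasurable (Eventually.of_forall h3)
  have hsplit : ∀ μ : Measure ℝ, IsProbabilityMeasure μ → Integrable (fun x : ℝ => x) μ →
      ∫ x, (∫ t in (0:ℝ)..x, φ t) ∂μ = ∫ x, (K * g' x - x * g x) ∂μ + c := by
    intro μ _ hμ
    have : ∀ x, ∫ t in (0:ℝ)..x, φ t = (K * g' x - x * g x) + c := fun x => by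
      rw [h6]
      ring
    simp_rw [this]
    rw [integral_add (hint μ inferInstance hμ) (integrable_const c)]
    simp
  -- The constant `c` cancels here, and the Gaussian side then vanishes by integration by parts.
  rw [hsplit _ inferInstance hid, hsplit _ inferInstance (Stein.integrable_id_gaussianReal _)]
  have hN : ∫ x, (K * g' x - x * g x) ∂gaussianReal 0 K.toNNReal = 0 := by
    have i1 := Stein.integrable_comp_add_gaussianReal K.toNNReal 0 hgc' h4
    have i2 := Stein.integrable_mul_comp_add_gaussianReal K.toNNReal 0 hgc h3
    have := Stein.integral_mul_comp_add_gaussianReal K.toNNReal 0 h1 hgc' h3 h4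
    simp only [add_zero] at i1 i2 this
    rw [integral_sub (i1.const_mul K) i2, integral_const_mul, this, Real.coe_toNNReal _ hK.le,
      sub_self]
  have hVle := h g g' g'' hS
  rw [hN, integral_map hV.aemeasurable (by fun_prop)]
  linarith

/-- Integration by parts with respect to an independent Gaussian summand. -/
theorem integral_bias_mul {K : ℝ} {v : ℝ≥0} {b F : Ω → ℝ} (hb : Measurable b) (hF : Measurable F)
    (hlaw : P.map b = gaussianReal 0 v) (hind : IndepFun b F P) {g g' g'' : ℝ → ℝ}
    (hS : IsSteinFun K g g' g'') :
    ∫ ω, b ω * g (b ω + F ω) ∂P = v * ∫ ω, g' (b ω + F ω) ∂P := by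
  have := Measure.isProbabilityMeasure_map (μ := P) hF.aemeasurable
  have hgc := hS.continuous
  have hgc' := hS.continuous_deriv
  have hpair := (indepFun_iff_map_prod_eq_prod_map_map hb.aemeasurable hF.aemeasurable).1 hind
  rw [hlaw] at hpair
  have key : ∀ H : ℝ × ℝ → ℝ, Continuous H → Integrable H ((gaussianReal 0 v).prod (P.map F)) →
      ∫ ω, H (b ω, F ω) ∂P = ∫ y, (∫ x, H (x, y) ∂gaussianReal 0 v) ∂(P.map F) := by
    intro H hH hi
    rw [← integral_prod_symm H hi, ← hpair, integral_map (by fun_prop) (by fun_prop)]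
  rw [key (fun p => p.1 * g (p.1 + p.2)) (by fun_prop) ?_,
    key (fun p => g' (p.1 + p.2)) (by fun_prop) ?_, ← integral_const_mul]
  · congr with y
    exact Stein.integral_mul_comp_add_gaussianReal v y hS.hasDerivAt hgc' hS.abs_le hS.abs_deriv_le
  · exact Integrable.of_bound (by fun_prop) _ (Eventually.of_forall fun p => hS.abs_deriv_le _)
  · exact ((Stein.integrable_id_gaussianReal v).comp_fst _).mul_bdd (c := 1) (by fun_prop)
      (Eventually.of_forall fun p => hS.abs_le _)

end SteinMethod

/-! ### The weights in the sum over proper subsets. -/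

section Combinatorics

variable {k : ℕ}

/-- Pairs `(A, j)` with `j ∉ A` correspond to pairs `(B, j)` with `j ∈ B` through `B = insert j A`.
-/
theorem sum_ssubsets_insert (c u : Finset (Fin k) → ℝ) :
    ∑ A ∈ (Finset.univ : Finset (Fin k)).ssubsets, ∑ j ∈ Aᶜ, c A * u (insert j A) =
      ∑ B ∈ (Finset.univ : Finset (Finset (Fin k))).erase ∅, ∑ j ∈ B, c (B.erase j) * u B := by
  rw [Finset.sum_sigma', Finset.sum_sigma']
  refine Finset.sum_bij' (fun p _ => ⟨insert p.2 p.1, p.2⟩) (fun p _ => ⟨p.1.erase p.2, p.2⟩)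
    ?_ ?_ ?_ ?_ ?_
  · rintro ⟨A, j⟩ h
    simp
  · rintro ⟨B, j⟩ h
    simp only [Finset.mem_sigma, Finset.mem_erase, Finset.mem_univ, and_true] at h
    simp only [Finset.mem_sigma, Finset.mem_ssubsets, Finset.mem_compl, Finset.mem_erase, ne_eq,
      not_true_eq_false, false_and, not_false_eq_true, and_true]
    refine Finset.ssubset_univ_iff.2 fun he => ?_
    have := he ▸ Finset.mem_univ j
    simp at this
  · rintro ⟨A, j⟩ h
    simp only [Finset.mem_sigma, Finset.mem_compl] at h
    simp [Finset.erase_insert h.2]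
  · rintro ⟨B, j⟩ h
    simp only [Finset.mem_sigma] at h
    simp [Finset.insert_erase h.2]
  · rintro ⟨A, j⟩ h
    simp only [Finset.mem_sigma, Finset.mem_compl] at h
    simp [Finset.erase_insert h.2]

/-- Each proper `A` occurs `k - |A|` times with a plus sign, hence with total weight `1 / k.choose
|A|`. Each nonempty `B` of size `m + 1` arises from `m + 1` sets, and `(m + 1) / (k.choose m * (k -
m))` is again `1 / k.choose (m + 1)`. Only the empty and the full set survive. -/
theorem sum_ssubsets_telescope (u : Finset (Fin k) → ℝ) :
    ∑ A ∈ (Finset.univ : Finset (Fin k)).ssubsets,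
      1 / ((k.choose A.card : ℝ) * ((k : ℝ) - A.card)) * ∑ j ∈ Aᶜ, (u A - u (insert j A)) =
      u ∅ - u Finset.univ := by
  set c : Finset (Fin k) → ℝ := fun A => 1 / ((k.choose A.card : ℝ) * ((k : ℝ) - A.card)) with hc
  set w : Finset (Fin k) → ℝ := fun A => u A / k.choose A.card with hw
  have hcard : ∀ A : Finset (Fin k), A.card ≤ k := fun A => by simpa using A.card_le_univ
  have hch : ∀ A : Finset (Fin k), (k.choose A.card : ℝ) ≠ 0 := fun A => by
    exact_mod_cast (Nat.choose_pos (hcard A)).ne'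
  have hss : (Finset.univ : Finset (Fin k)).ssubsets =
      (Finset.univ : Finset (Finset (Fin k))).erase Finset.univ := by
    ext A
    simp [Finset.ssubset_univ_iff]
  have h1 : ∑ A ∈ (Finset.univ : Finset (Fin k)).ssubsets, ∑ j ∈ Aᶜ, c A * u A =
      ∑ A ∈ (Finset.univ : Finset (Finset (Fin k))).erase Finset.univ, w A := by
    rw [hss]
    refine Finset.sum_congr rfl fun A hA => ?_
    have hlt : A.card < k := by
      refine lt_of_le_of_ne (hcard A) fun he => (Finset.mem_erase.1 hA).1 ?_
      exact Finset.card_eq_iff_eq_univ A |>.1 (by simpa using he)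
    have hne : ((k : ℝ) - A.card) ≠ 0 := by
      have : (A.card : ℝ) < k := by exact_mod_cast hlt
      linarith
    rw [Finset.sum_const, Finset.card_compl, Fintype.card_fin, nsmul_eq_mul,
      Nat.cast_sub hlt.le, hc, hw]
    have := hch A
    field_simp
  have h2 : ∑ A ∈ (Finset.univ : Finset (Fin k)).ssubsets, ∑ j ∈ Aᶜ, c A * u (insert j A) =
      ∑ B ∈ (Finset.univ : Finset (Finset (Fin k))).erase ∅, w B := by
    rw [sum_ssubsets_insert]
    refine Finset.sum_congr rfl fun B hB => ?_
    obtain ⟨m, hm⟩ : ∃ m, B.card = m + 1 := Nat.exists_eq_succ_of_ne_zero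
      (Finset.card_ne_zero.2 (Finset.nonempty_iff_ne_empty.2 (Finset.mem_erase.1 hB).1))
    have hmk : m + 1 ≤ k := hm ▸ hcard B
    have hterm : ∀ j ∈ B, c (B.erase j) * u B = 1 / ((k.choose m : ℝ) * ((k : ℝ) - m)) * u B := by
      intro j hj
      simp only [hc, Finset.card_erase_of_mem hj, hm, Nat.add_sub_cancel]
    rw [Finset.sum_congr rfl hterm, Finset.sum_const, hm, nsmul_eq_mul]
    have hne : ((k : ℝ) - m) ≠ 0 := by
      have : ((m + 1 : ℕ) : ℝ) ≤ k := by exact_mod_cast hmk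
      push_cast at this
      linarith
    have hc1 : (k.choose m : ℝ) ≠ 0 := by
      exact_mod_cast (Nat.choose_pos (by omega : m ≤ k)).ne'
    have hc2 : (k.choose (m + 1) : ℝ) ≠ 0 := hm ▸ hch B
    have hid : (k.choose (m + 1) : ℝ) * (m + 1) = k.choose m * ((k : ℝ) - m) := by
      rw [← Nat.cast_sub (by omega : m ≤ k)]
      exact_mod_cast Nat.choose_succ_right_eq k m
    simp only [hw, hm]
    push_cast
    field_simp
    linear_combination u B * hid
  have h3 : ∑ A ∈ (Finset.univ : Finset (Fin k)).ssubsets,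
      c A * ∑ j ∈ Aᶜ, (u A - u (insert j A)) = (∑ A ∈ (Finset.univ : Finset (Fin k)).ssubsets,
        ∑ j ∈ Aᶜ, c A * u A) - ∑ A ∈ (Finset.univ : Finset (Fin k)).ssubsets,
        ∑ j ∈ Aᶜ, c A * u (insert j A) := by
    simp only [← Finset.mul_sum, ← Finset.sum_sub_distrib, ← mul_sub]
  refine h3.trans ?_
  rw [h1, h2]
  have e1 := Finset.add_sum_erase Finset.univ w (Finset.mem_univ Finset.univ)
  have e2 := Finset.add_sum_erase Finset.univ w (Finset.mem_univ ∅)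
  have e3 : w ∅ = u ∅ := by simp [hw]
  have e4 : w Finset.univ = u Finset.univ := by simp [hw]
  rw [e3] at e2
  rw [e4] at e1
  linarith

/-- Each coordinate carries total weight `1`: telescope the additive set function `A ↦ ∑ i ∈ Aᶜ, d
i`. -/
theorem sum_ssubsets_const (d : Fin k → ℝ) :
    ∑ A ∈ (Finset.univ : Finset (Fin k)).ssubsets,
      1 / ((k.choose A.card : ℝ) * ((k : ℝ) - A.card)) * ∑ j ∈ Aᶜ, d j = ∑ j, d j := by
  have h := sum_ssubsets_telescope (fun A : Finset (Fin k) => ∑ i ∈ Aᶜ, d i)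
  simp only [Finset.compl_empty, Finset.compl_univ, Finset.sum_empty, sub_zero] at h
  rw [← h]
  refine Finset.sum_congr rfl fun A _ => ?_
  congr 1
  refine Finset.sum_congr rfl fun j hj => ?_
  rw [Finset.compl_insert, eq_sub_iff_add_eq, Finset.add_sum_erase _ _ hj]

end Combinatorics

/-- Young's inequality; the difference is `(2a + c)(a - c)² / 3`. -/
theorem sq_mul_le_of_nonneg {a c : ℝ} (ha : 0 ≤ a) (hc : 0 ≤ c) :
    a ^ 2 * c ≤ (2 * a ^ 3 + c ^ 3) / 3 := by
  nlinarith [mul_nonneg (add_nonneg (add_nonneg ha ha) hc) (sq_nonneg (a - c))]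

/-! ### Approximate integration by parts for exchangeable families. -/

section Exchange

variable {Ω : Type*} [MeasurableSpace Ω] {P : Measure Ω} {k : ℕ}

/-- The statistic `T` in terms of the values `U A` of the function at the resampled vectors. -/
noncomputable def exchangeT (U : Finset (Fin k) → Ω → ℝ) (ω : Ω) : ℝ :=
  1 / 2 * ∑ A ∈ (Finset.univ : Finset (Fin k)).ssubsets,
    1 / ((k.choose A.card : ℝ) * ((k : ℝ) - A.card)) *
      ∑ j ∈ Aᶜ, (U ∅ ω - U {j} ω) * (U A ω - U (insert j A) ω)

/-- A family indexed by subsets whose joint law with `b` is invariant under all symmetric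
differences. -/
def IsExchangeable (P : Measure Ω) (b : Ω → ℝ) (U : Finset (Fin k) → Ω → ℝ) : Prop :=
  ∀ S, IdentDistrib (fun ω => (b ω, fun A => U A ω)) (fun ω => (b ω, fun A => U (symmDiff A S) ω))
    P P

variable {b : Ω → ℝ} {U : Finset (Fin k) → Ω → ℝ}

theorem IsExchangeable.memLp (h : IsExchangeable P b U) (hL : MemLp (U ∅) 4 P)
    (A : Finset (Fin k)) : MemLp (U A) 4 P := by
  have h1 := (h A).comp (u := fun p : ℝ × (Finset (Fin k) → ℝ) => p.2 ∅) (by fun_prop)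
  have h2 : IdentDistrib (U ∅) (U A) P P := by
    have e : symmDiff (∅ : Finset (Fin k)) A = A := bot_symmDiff A
    simpa only [Function.comp_def, e] using h1
  exact h2.memLp_iff.1 hL

theorem memLp_two_mul {f g : Ω → ℝ} (hf : MemLp f 4 P) (hg : MemLp g 4 P) :
    MemLp (fun ω => f ω * g ω) 2 P := by
  have : ENNReal.HolderTriple 4 4 2 := ⟨by
    rw [← two_mul, ← ENNReal.toReal_eq_toReal_iff' (by finiteness) (by finiteness)]
    norm_num⟩
  exact hg.mul hf

theorem memLp_two_exchangeT (h : IsExchangeable P b U) (hL : MemLp (U ∅) 4 P) :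
    MemLp (exchangeT U) 2 P := by
  have hm := h.memLp hL
  refine MemLp.const_mul ?_ _
  refine memLp_finsetSum _ fun A _ => MemLp.const_mul ?_ _
  exact memLp_finsetSum _ fun j _ => memLp_two_mul ((hm _).sub (hm _)) ((hm _).sub (hm _))

variable [IsProbabilityMeasure P]

theorem integrable_abs_pow_three {f : Ω → ℝ} (hf : MemLp f 4 P) :
    Integrable (fun ω => |f ω| ^ 3) P := by
  have := (hf.mono_exponent (p := 3) (by norm_num)).integrable_norm_pow (p := 3) (by norm_num)
  simpa using this

/-- By `hfull`, `U ∅` may be replaced by `U ∅ - U univ`, which telescopes into increments `U A - U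
(insert j A)`. The symmetry `S = {j}` reverses such an increment, so `g (V)` becomes half the
difference of `g` at the original and the `j`-resampled point; Taylor's formula turns this into `g'`
times the increment of `U ∅`, with an error of third order. -/
theorem exchange_integral_mul_ge (h : IsExchangeable P b U) (hL : MemLp (U ∅) 4 P)
    (hb : Measurable b) (hU : ∀ A, Measurable (U A)) {K : ℝ} {g g' g'' : ℝ → ℝ} (hK : 0 < K)
    (hS : IsSteinFun K g g' g'') (hfull : ∫ ω, g (b ω + U ∅ ω) * U Finset.univ ω ∂P = 0) :
    (∫ ω, exchangeT U ω * g' (b ω + U ∅ ω) ∂P) -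
      1 / (2 * K) * ∑ j, ∫ ω, |U ∅ ω - U {j} ω| ^ 3 ∂P ≤ ∫ ω, U ∅ ω * g (b ω + U ∅ ω) ∂P := by
  have hgc := hS.continuous
  have hgc' := hS.continuous_deriv
  have hm := h.memLp hL
  have hone : ∀ {f : Ω → ℝ}, MemLp f 4 P → Integrable f P := fun hf =>
    hf.integrable (by norm_num)
  have hgi : ∀ B {f : Ω → ℝ}, Integrable f P → Integrable (fun ω => g (b ω + U B ω) * f ω) P :=
    fun B f hf => hf.bdd_mul (c := 1) (by fun_prop) (Eventually.of_forall fun ω => hS.abs_le _)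
  have hgi' : ∀ {f : Ω → ℝ}, Integrable f P → Integrable (fun ω => g' (b ω + U ∅ ω) * f ω) P :=
    fun hf => hf.bdd_mul (by fun_prop) (Eventually.of_forall fun ω => hS.abs_deriv_le _)
  have hD : ∀ A B, MemLp (fun ω => U A ω - U B ω) 4 P := fun A B => (hm A).sub (hm B)
  have hDD : ∀ A B C D, Integrable (fun ω => (U A ω - U B ω) * (U C ω - U D ω)) P :=
    fun A B C D => (memLp_two_mul (hD A B) (hD C D)).integrable (by norm_num)
  -- exchanging the `j`-th coordinates
  have hswap : ∀ A : Finset (Fin k), ∀ j ∉ A, ∫ ω, g (b ω + U ∅ ω) * (U A ω - U (insert j A) ω) ∂P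
      = 1 / 2 * ∫ ω, (g (b ω + U ∅ ω) - g (b ω + U {j} ω)) * (U A ω - U (insert j A) ω) ∂P := by
    intro A j hj
    have h1 := ((h {j}).comp (u := fun p : ℝ × (Finset (Fin k) → ℝ) =>
      g (p.1 + p.2 ∅) * (p.2 A - p.2 (insert j A))) (by fun_prop)).integral_eq
    have e1 : symmDiff A {j} = insert j A := by
      ext i
      by_cases hi : i = j <;> simp [Finset.mem_symmDiff, hi, hj]
    have e2 : symmDiff (insert j A) {j} = A := by
      rw [← e1, symmDiff_symmDiff_cancel_right]
    have e3 : symmDiff (∅ : Finset (Fin k)) {j} = {j} := bot_symmDiff _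
    simp only [Function.comp_def, e1, e2, e3] at h1
    have h2 : ∫ ω, g (b ω + U {j} ω) * (U (insert j A) ω - U A ω) ∂P =
        -∫ ω, g (b ω + U {j} ω) * (U A ω - U (insert j A) ω) ∂P := by
      rw [← integral_neg]
      congr with ω
      ring
    simp only [sub_mul]
    rw [integral_sub (hgi _ (hone (hD _ _))) (hgi _ (hone (hD _ _)))]
    linarith
  -- the Taylor estimate
  have htaylor : ∀ A : Finset (Fin k), ∀ j ∉ A,
      (∫ ω, g' (b ω + U ∅ ω) * ((U ∅ ω - U {j} ω) * (U A ω - U (insert j A) ω)) ∂P) -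
        1 / K * ∫ ω, |U ∅ ω - U {j} ω| ^ 3 ∂P ≤
      ∫ ω, (g (b ω + U ∅ ω) - g (b ω + U {j} ω)) * (U A ω - U (insert j A) ω) ∂P := by
    intro A j hj
    -- The symmetry `S = A` carries the increment at `A` to the one at `∅`, so Young's inequality
    -- leaves a single third moment.
    have hid : ∫ ω, |U A ω - U (insert j A) ω| ^ 3 ∂P = ∫ ω, |U ∅ ω - U {j} ω| ^ 3 ∂P := by
      have h1 := ((h A).comp (u := fun p : ℝ × (Finset (Fin k) → ℝ) =>
        |p.2 A - p.2 (insert j A)| ^ 3) (by fun_prop)).integral_eq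
      have e1 : symmDiff (insert j A) A = {j} := by
        ext i
        by_cases hi : i = j <;> simp [Finset.mem_symmDiff, hi, hj]
      simpa only [Function.comp_def, e1, symmDiff_self, Finset.bot_eq_empty] using h1
    have i3 : ∀ A B, Integrable (fun ω => |U A ω - U B ω| ^ 3) P := fun A B =>
      integrable_abs_pow_three (hD A B)
    have i4 : Integrable (fun ω =>
        (2 * |U ∅ ω - U {j} ω| ^ 3 + |U A ω - U (insert j A) ω| ^ 3) / 3) P :=
      (((i3 _ _).const_mul 2).add (i3 _ _)).div_const 3
    have hle : ∫ ω, (g' (b ω + U ∅ ω) * ((U ∅ ω - U {j} ω) * (U A ω - U (insert j A) ω)) -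
        1 / K * ((2 * |U ∅ ω - U {j} ω| ^ 3 + |U A ω - U (insert j A) ω| ^ 3) / 3)) ∂P ≤
        ∫ ω, (g (b ω + U ∅ ω) - g (b ω + U {j} ω)) * (U A ω - U (insert j A) ω) ∂P := by
      refine integral_mono ((hgi' (hDD _ _ _ _)).sub (i4.const_mul _)) ?_ fun ω => ?_
      · simp only [sub_mul]
        exact (hgi _ (hone (hD _ _))).sub (hgi _ (hone (hD _ _)))
      · have ht := hS.abs_taylor_le (b ω + U ∅ ω) (b ω + U {j} ω)
        rw [add_sub_add_left_eq_sub] at ht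
        have hy := sq_mul_le_of_nonneg (abs_nonneg (U ∅ ω - U {j} ω))
          (abs_nonneg (U A ω - U (insert j A) ω))
        rw [sq_abs] at hy
        have hprod : |(g (b ω + U ∅ ω) - g (b ω + U {j} ω) - g' (b ω + U ∅ ω) *
            (U ∅ ω - U {j} ω)) * (U A ω - U (insert j A) ω)| ≤ 1 / K *
            ((2 * |U ∅ ω - U {j} ω| ^ 3 + |U A ω - U (insert j A) ω| ^ 3) / 3) := by
          rw [abs_mul]
          calc _ ≤ 1 / K * (U ∅ ω - U {j} ω) ^ 2 * |U A ω - U (insert j A) ω| := by gcongr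
            _ = 1 / K * ((U ∅ ω - U {j} ω) ^ 2 * |U A ω - U (insert j A) ω|) := by ring
            _ ≤ _ := by gcongr
        have := (abs_le.1 hprod).1
        simp only
        linarith
    rw [integral_sub (hgi' (hDD _ _ _ _)) (i4.const_mul _), integral_const_mul, integral_div,
      integral_add ((i3 _ _).const_mul 2) (i3 _ _), integral_const_mul, hid] at hle
    refine le_trans (le_of_eq ?_) hle
    ring
  have hterm : ∀ A : Finset (Fin k), ∀ j ∈ Aᶜ,
      (1 / 2 * ∫ ω, g' (b ω + U ∅ ω) * ((U ∅ ω - U {j} ω) * (U A ω - U (insert j A) ω)) ∂P) -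
        1 / (2 * K) * ∫ ω, |U ∅ ω - U {j} ω| ^ 3 ∂P ≤
      ∫ ω, g (b ω + U ∅ ω) * (U A ω - U (insert j A) ω) ∂P := by
    intro A j hj
    rw [Finset.mem_compl] at hj
    rw [hswap A j hj]
    have := htaylor A j hj
    have e : 1 / (2 * K) = 1 / 2 * (1 / K) := by field_simp
    rw [e]
    linarith
  have hmain : ∫ ω, U ∅ ω * g (b ω + U ∅ ω) ∂P =
      ∑ A ∈ (Finset.univ : Finset (Fin k)).ssubsets,
        1 / ((k.choose A.card : ℝ) * ((k : ℝ) - A.card)) *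
          ∑ j ∈ Aᶜ, ∫ ω, g (b ω + U ∅ ω) * (U A ω - U (insert j A) ω) ∂P := by
    calc ∫ ω, U ∅ ω * g (b ω + U ∅ ω) ∂P
        = ∫ ω, g (b ω + U ∅ ω) * (U ∅ ω - U Finset.univ ω) ∂P := by
          simp only [mul_sub]
          rw [integral_sub (hgi _ (hone (hm _))) (hgi _ (hone (hm _))), hfull, sub_zero]
          simp only [mul_comm]
      _ = ∫ ω, ∑ A ∈ (Finset.univ : Finset (Fin k)).ssubsets,
            1 / ((k.choose A.card : ℝ) * ((k : ℝ) - A.card)) *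
              ∑ j ∈ Aᶜ, g (b ω + U ∅ ω) * (U A ω - U (insert j A) ω) ∂P := by
          congr with ω
          rw [← sum_ssubsets_telescope (fun A => U A ω), Finset.mul_sum]
          refine Finset.sum_congr rfl fun A _ => ?_
          rw [mul_left_comm, Finset.mul_sum]
      _ = _ := by
          rw [integral_finsetSum _ fun A _ => (integrable_finsetSum _ fun j _ =>
            hgi _ (hone (hD _ _))).const_mul _]
          refine Finset.sum_congr rfl fun A _ => ?_
          rw [integral_const_mul, integral_finsetSum _ fun j _ => hgi _ (hone (hD _ _))]
  have hTg : ∫ ω, exchangeT U ω * g' (b ω + U ∅ ω) ∂P =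
      ∑ A ∈ (Finset.univ : Finset (Fin k)).ssubsets,
        1 / ((k.choose A.card : ℝ) * ((k : ℝ) - A.card)) * ∑ j ∈ Aᶜ, (1 / 2 *
          ∫ ω, g' (b ω + U ∅ ω) * ((U ∅ ω - U {j} ω) * (U A ω - U (insert j A) ω)) ∂P) := by
    calc _ = ∫ ω, ∑ A ∈ (Finset.univ : Finset (Fin k)).ssubsets,
            1 / ((k.choose A.card : ℝ) * ((k : ℝ) - A.card)) * ∑ j ∈ Aᶜ, 1 / 2 *
              (g' (b ω + U ∅ ω) * ((U ∅ ω - U {j} ω) * (U A ω - U (insert j A) ω))) ∂P := by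
          congr with ω
          rw [exchangeT, mul_assoc, Finset.sum_mul, Finset.mul_sum]
          refine Finset.sum_congr rfl fun A _ => ?_
          rw [mul_assoc, Finset.sum_mul, mul_left_comm, Finset.mul_sum]
          congr 1
          refine Finset.sum_congr rfl fun j _ => ?_
          ring
      _ = _ := by
          rw [integral_finsetSum _ fun A _ => (integrable_finsetSum _ fun j _ =>
            (hgi' (hDD _ _ _ _)).const_mul _).const_mul _]
          refine Finset.sum_congr rfl fun A _ => ?_
          rw [integral_const_mul, integral_finsetSum _ fun j _ =>
            (hgi' (hDD _ _ _ _)).const_mul _]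
          simp only [integral_const_mul]
  -- The error is spread over the subsets with the same weights, which allows a termwise comparison.
  rw [hmain, hTg, Finset.mul_sum, ← sum_ssubsets_const, ← Finset.sum_sub_distrib]
  refine Finset.sum_le_sum fun A hA => ?_
  rw [← mul_sub, ← Finset.sum_sub_distrib]
  have hcard : (A.card : ℝ) ≤ k := by
    exact_mod_cast (by simpa using A.card_le_univ : A.card ≤ k)
  have : 0 ≤ (k : ℝ) - A.card := by linarith
  gcongr with j hj
  exact hterm A j hj

end Exchange

theorem memLp_four_of_integrable {Ω : Type*} [MeasurableSpace Ω] {P : Measure Ω} {f : Ω → ℝ}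
    (hf : Measurable f) (h : Integrable (fun ω => f ω ^ 4) P) : MemLp f 4 P := by
  rw [← integrable_norm_rpow_iff hf.aestronglyMeasurable (by norm_num) (by norm_num)]
  refine h.congr (Eventually.of_forall fun ω => ?_)
  have : (4 : ℝ≥0∞).toReal = (4 : ℕ) := by norm_num
  simp only [this, Real.rpow_natCast, Real.norm_eq_abs, Even.pow_abs (n := 4) (by decide)]

theorem abs_integral_mul_le_sqrt {Ω : Type*} {_ : MeasurableSpace Ω} {P : Measure Ω}
    [IsProbabilityMeasure P] {Y H : Ω → ℝ} (hY : MemLp Y 2 P) {c : ℝ} (hc : 0 ≤ c)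
    (hH : ∀ ω, |H ω| ≤ c) : ∫ ω, Y ω * H ω ∂P ≤ c * √(∫ ω, Y ω ^ 2 ∂P) := by
  have h1 : ∫ ω, Y ω * H ω ∂P ≤ ∫ ω, c * |Y ω| ∂P := by
    -- `H` is not assumed measurable; without integrability the integral on the left is `0`.
    by_cases hi : Integrable (fun ω => Y ω * H ω) P
    · refine integral_mono hi ((hY.integrable (by norm_num)).abs.const_mul c) fun ω => ?_
      calc Y ω * H ω ≤ |Y ω| * |H ω| := (le_abs_self _).trans_eq (abs_mul _ _)
        _ ≤ |Y ω| * c := by gcongr; exact hH ω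
        _ = c * |Y ω| := mul_comm _ _
    · rw [integral_undef hi]
      positivity
  refine h1.trans ?_
  rw [integral_const_mul]
  gcongr
  refine Real.le_sqrt_of_sq_le ?_
  have h2 : MemLp (fun ω => |Y ω|) 2 P := hY.abs
  have := variance_nonneg (fun ω => |Y ω|) P
  rw [variance_eq_sub h2] at this
  simp only [Pi.pow_apply, sq_abs] at this
  linarith

/-! ### Functions of independent variables with a Gaussian bias. -/

section Resampling

variable {k : ℕ} {E : Type*}

theorem resample_empty (x x' : Fin k → E) : resample x x' ∅ = x := by
  ext i; simp [resample]

theorem resample_univ (x x' : Fin k → E) : resample x x' Finset.univ = x' := by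
  ext i; simp [resample]

theorem update_resample (x x' : Fin k → E) (A : Finset (Fin k)) (j : Fin k) :
    Function.update (resample x x' A) j (x' j) = resample x x' (insert j A) := by
  ext i
  by_cases h : i = j
  · subst h
    simp [resample]
  · simp [resample, h]

/-- Coordinates exchanged twice return to their place. Swapping the two vectors on `S` therefore
acts on the index sets by symmetric difference. -/
theorem resample_resample (x x' : Fin k → E) (A S : Finset (Fin k)) :
    resample (resample x x' S) (resample x' x S) A = resample x x' (symmDiff A S) := by
  ext i
  by_cases h : i ∈ A <;> by_cases h' : i ∈ S <;> simp [resample, h, h', Finset.mem_symmDiff]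

theorem discreteDiff_resample (f : (Fin k → E) → ℝ) (x x' : Fin k → E) (A : Finset (Fin k))
    (j : Fin k) : discreteDiff f x' j (resample x x' A) =
      f (resample x x' A) - f (resample x x' (insert j A)) := by
  rw [discreteDiff, update_resample]

theorem discreteDiff_eq (f : (Fin k → E) → ℝ) (x x' : Fin k → E) (j : Fin k) :
    discreteDiff f x' j x = f (resample x x' ∅) - f (resample x x' {j}) := by
  have := discreteDiff_resample f x x' ∅ j
  rwa [resample_empty, insert_empty_eq, ← resample_empty x x'] at this

theorem steinT_eq_exchangeT (f : (Fin k → E) → ℝ) {Ω : Type*} (X X' : Fin k → Ω → E) (ω : Ω) :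
    steinT f (fun i => X i ω) (fun i => X' i ω) =
      exchangeT (fun A ω => f (resample (fun i => X i ω) (fun i => X' i ω) A)) ω := by
  simp only [steinT, exchangeT, discreteDiff_resample]
  simp only [discreteDiff_eq]

variable [MeasurableSpace E]

theorem measurable_resample (A : Finset (Fin k)) :
    Measurable fun p : (Fin k → E) × (Fin k → E) => resample p.1 p.2 A := by
  refine measurable_pi_lambda _ fun i => ?_
  by_cases h : i ∈ A
  · simp only [resample, h, if_true]
    fun_prop
  · simp only [resample, h, if_false]
    fun_prop

/-- Seen as a vector of pairs, the map swaps the pairs with index in `S`, and each swap preserves `μ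
i ⊗ μ i`. -/
theorem measurePreserving_resample (μ : Fin k → Measure E) [∀ i, IsProbabilityMeasure (μ i)]
    (S : Finset (Fin k)) :
    MeasurePreserving (fun p : (Fin k → E) × (Fin k → E) => (resample p.1 p.2 S, resample p.2 p.1 S))
      ((Measure.pi μ).prod (Measure.pi μ)) ((Measure.pi μ).prod (Measure.pi μ)) := by
  have e := measurePreserving_arrowProdEquivProdArrow E E (Fin k) μ μ
  have hcomp : MeasurePreserving (fun (q : Fin k → E × E) i => if i ∈ S then (q i).swap else q i)
      (Measure.pi fun i => (μ i).prod (μ i)) (Measure.pi fun i => (μ i).prod (μ i)) := by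
    refine measurePreserving_pi _ _ (f := fun i (p : E × E) => if i ∈ S then p.swap else p) fun i => ?_
    by_cases h : i ∈ S
    · simp only [h, if_true]
      exact Measure.measurePreserving_swap
    · simp only [h, if_false]
      exact MeasurePreserving.id _
  have h := (e.comp hcomp).comp (MeasurePreserving.symm _ e)
  convert h using 1
  ext p i
  · by_cases hi : i ∈ S <;>
      simp [resample, hi, MeasurableEquiv.arrowProdEquivProdArrow, Equiv.arrowProdEquivProdArrow]
  · by_cases hi : i ∈ S <;>
      simp [resample, hi, MeasurableEquiv.arrowProdEquivProdArrow, Equiv.arrowProdEquivProdArrow]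

variable {Ω : Type*} {mΩ : MeasurableSpace Ω} {P : Measure Ω} [IsProbabilityMeasure P]

theorem isExchangeable_resample {f : (Fin k → E) → ℝ} {X X' : Fin k → Ω → E} {b : Ω → ℝ}
    (hf : Measurable f) (hX : ∀ i, Measurable (X i)) (hX' : ∀ i, Measurable (X' i))
    (hb : Measurable b) (hind : iIndepFun X P)
    (hlaw : P.map (fun ω i => X' i ω) = P.map (fun ω i => X i ω))
    (hXX' : IndepFun (fun ω i => X i ω) (fun ω i => X' i ω) P)
    (hbX : IndepFun b (fun ω => ((fun i => X i ω), (fun i => X' i ω))) P) :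
    IsExchangeable P b fun A ω => f (resample (fun i => X i ω) (fun i => X' i ω) A) := by
  intro S
  have hXm : Measurable fun ω i => X i ω := measurable_pi_lambda _ hX
  have hXm' : Measurable fun ω i => X' i ω := measurable_pi_lambda _ hX'
  have hprob : ∀ i, IsProbabilityMeasure (P.map (X i)) := fun i =>
    Measure.isProbabilityMeasure_map (hX i).aemeasurable
  have hpi := hind.map_fun_eq_pi_map fun i => (hX i).aemeasurable
  have hpair : P.map (fun ω => ((fun i => X i ω), (fun i => X' i ω))) =
      (Measure.pi fun i => P.map (X i)).prod (Measure.pi fun i => P.map (X i)) := by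
    rw [(indepFun_iff_map_prod_eq_prod_map_map hXm.aemeasurable hXm'.aemeasurable).1 hXX', hlaw,
      hpi]
  have htriple : P.map (fun ω => (b ω, ((fun i => X i ω), (fun i => X' i ω)))) = (P.map b).prod
      ((Measure.pi fun i => P.map (X i)).prod (Measure.pi fun i => P.map (X i))) := by
    rw [(indepFun_iff_map_prod_eq_prod_map_map hb.aemeasurable
      (hXm.prodMk hXm').aemeasurable).1 hbX, hpair]
  have hbp := Measure.isProbabilityMeasure_map (μ := P) hb.aemeasurable
  have hpres := (MeasurePreserving.id (P.map b)).prod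
    (measurePreserving_resample (fun i => P.map (X i)) S)
  rw [← htriple] at hpres
  have hr := measurable_resample (E := E) (k := k)
  have hH : Measurable fun q : ℝ × ((Fin k → E) × (Fin k → E)) =>
      (q.1, fun A : Finset (Fin k) => f (resample q.2.1 q.2.2 A)) :=
    measurable_fst.prodMk (measurable_pi_lambda _ fun A =>
      hf.comp ((hr A).comp measurable_snd))
  have htm : Measurable fun ω => (b ω, ((fun i => X i ω), (fun i => X' i ω))) :=
    hb.prodMk (hXm.prodMk hXm')
  refine ⟨(hH.comp htm).aemeasurable, ?_, ?_⟩
  · exact (hb.prodMk (measurable_pi_lambda _ fun A =>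
      hf.comp ((hr _).comp (hXm.prodMk hXm')))).aemeasurable
  · change P.map ((fun q : ℝ × ((Fin k → E) × (Fin k → E)) =>
      (q.1, fun A : Finset (Fin k) => f (resample q.2.1 q.2.2 A))) ∘
      fun ω => (b ω, ((fun i => X i ω), (fun i => X' i ω)))) = _
    rw [← Measure.map_map hH htm]
    nth_rw 1 [← hpres.map_eq]
    rw [Measure.map_map hpres.measurable htm, Measure.map_map hH (hpres.measurable.comp htm)]
    congr 1
    ext ω : 1
    simp [resample_resample]

/-- Normal approximation for a function of independent variables plus a Gaussian bias. -/
theorem wassersteinOne_bias_add_le {Cb : ℝ} (hCb : 0 ≤ Cb) {f : (Fin k → E) → ℝ}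
    {X X' : Fin k → Ω → E} {b : Ω → ℝ} {K : ℝ}
    (hf : Measurable f) (hX : ∀ i, Measurable (X i)) (hX' : ∀ i, Measurable (X' i))
    (hb : Measurable b) (hK : 0 < K) (hblaw : P.map b = gaussianReal 0 Cb.toNNReal)
    (hind : iIndepFun X P)
    (hlaw : P.map (fun ω i => X' i ω) = P.map (fun ω i => X i ω))
    (hXX' : IndepFun (fun ω i => X i ω) (fun ω i => X' i ω) P)
    (hbX : IndepFun b (fun ω => ((fun i => X i ω), (fun i => X' i ω))) P)
    (hL : Integrable (fun ω => f (fun i => X i ω) ^ 4) P)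
    (hmean : ∫ ω, f (fun i => X i ω) ∂P = 0) {V : Ω → ℝ}
    (hV : V = fun ω => b ω + f (fun i => X i ω)) :
    wassersteinOne (P.map V) (gaussianReal 0 K.toNNReal) ≤
      ENNReal.ofReal
        (√(2 / (K * Real.pi)) *
            √(∫ ω, (P[fun ω' => K - Cb - steinT f (fun i => X i ω') (fun i => X' i ω')
                | MeasurableSpace.comap V inferInstance]) ω ^ 2 ∂P)
          + 1 / (2 * K) * ∑ j, ∫ ω,
              |discreteDiff f (fun i => X' i ω) j (fun i => X i ω)| ^ 3 ∂P) := by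
  set U : Finset (Fin k) → Ω → ℝ := fun A ω => f (resample (fun i => X i ω) (fun i => X' i ω) A)
    with hUdef
  have hXm : Measurable fun ω i => X i ω := measurable_pi_lambda _ hX
  have hXm' : Measurable fun ω i => X' i ω := measurable_pi_lambda _ hX'
  have hU : ∀ A, Measurable (U A) := fun A =>
    hf.comp ((measurable_resample A).comp (hXm.prodMk hXm'))
  have hex : IsExchangeable P b U := isExchangeable_resample hf hX hX' hb hind hlaw hXX' hbX
  have hU0 : ∀ ω, U ∅ ω = f (fun i => X i ω) := fun ω => by simp only [hUdef, resample_empty]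
  have hU1 : ∀ ω, U Finset.univ ω = f (fun i => X' i ω) := fun ω => by
    simp only [hUdef, resample_univ]
  have hL4 : MemLp (U ∅) 4 P := by
    refine memLp_four_of_integrable (hU ∅) ?_
    simpa only [hU0] using hL
  have hVU : V = fun ω => b ω + U ∅ ω := by simp only [hV, hU0]
  have hVm : Measurable V := by
    rw [hVU]
    exact hb.add (hU ∅)
  have hbi : Integrable b P := by
    have := Stein.integrable_id_gaussianReal Cb.toNNReal
    rw [← hblaw] at this
    exact this.comp_measurable hb
  have hUi : Integrable (U ∅) P := hL4.integrable (by norm_num)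
  have hbind : IndepFun b (U ∅) P :=
    hbX.comp measurable_id (hf.comp (measurable_resample ∅))
  simp only [steinT_eq_exchangeT, discreteDiff_eq]
  have hT := memLp_two_exchangeT hex hL4
  have hS2 : MemLp (fun ω => K - Cb - exchangeT U ω) 2 P := (memLp_const _).sub hT
  have hSi : Integrable (fun ω => K - Cb - exchangeT U ω) P := hS2.integrable (by norm_num)
  refine wassersteinOne_gaussianReal_le hVm (hVU ▸ hbi.add hUi) hK fun g g' g'' hS => ?_
  have hgc := hS.continuous
  have hgc' := hS.continuous_deriv
  -- `U univ = f(X')` is centred and independent of `(b, X)`; the latter follows by reassociating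
  -- the product law of `(b, (X, X'))`.
  have hfull : ∫ ω, g (b ω + U ∅ ω) * U Finset.univ ω ∂P = 0 := by
    have hb' : IndepFun (fun ω => (b ω, fun i => X i ω)) (fun ω i => X' i ω) P := by
      rw [indepFun_iff_map_prod_eq_prod_map_map (hb.prodMk hXm).aemeasurable hXm'.aemeasurable]
      have h1 := (indepFun_iff_map_prod_eq_prod_map_map hb.aemeasurable
        (hXm.prodMk hXm').aemeasurable).1 hbX
      rw [(indepFun_iff_map_prod_eq_prod_map_map hXm.aemeasurable hXm'.aemeasurable).1 hXX'] at h1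
      have h2 : IndepFun b (fun ω i => X i ω) P := hbX.comp measurable_id measurable_fst
      rw [(indepFun_iff_map_prod_eq_prod_map_map hb.aemeasurable hXm.aemeasurable).1 h2]
      have hp1 := Measure.isProbabilityMeasure_map (μ := P) hb.aemeasurable
      have hp2 := Measure.isProbabilityMeasure_map (μ := P) hXm.aemeasurable
      have hp3 := Measure.isProbabilityMeasure_map (μ := P) hXm'.aemeasurable
      have h3 := congrArg (Measure.map MeasurableEquiv.prodAssoc.symm) h1
      rw [Measure.map_map (MeasurableEquiv.measurable _) (hb.prodMk (hXm.prodMk hXm'))] at h3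
      rw [((measurePreserving_prodAssoc _ _ _).symm _).map_eq] at h3
      exact h3
    have h1 : IndepFun (fun ω => g (b ω + U ∅ ω)) (fun ω => U Finset.univ ω) P := by
      have := hb'.comp (φ := fun p : ℝ × (Fin k → E) => g (p.1 + f p.2)) (ψ := f)
        (by fun_prop) hf
      simpa only [hU0, hU1, Function.comp_def] using this
    rw [h1.integral_fun_mul_eq_mul_integral (by fun_prop) (by fun_prop)]
    have h2 : ∫ ω, U Finset.univ ω ∂P = 0 := by
      simp only [hU1]
      rw [← integral_map (f := f) hXm'.aemeasurable hf.aestronglyMeasurable, hlaw,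
        integral_map hXm.aemeasurable hf.aestronglyMeasurable, hmean]
    rw [h2, mul_zero]
  have hge := exchange_integral_mul_ge hex hL4 hb hU hK hS hfull
  have hbias := integral_bias_mul hb (hU ∅) hblaw hbind hS
  rw [Real.coe_toNNReal _ hCb] at hbias
  have ig' : Integrable (fun ω => g' (b ω + U ∅ ω)) P :=
    Integrable.of_bound (by fun_prop) _ (Eventually.of_forall fun ω => hS.abs_deriv_le _)
  have ibg : Integrable (fun ω => b ω * g (b ω + U ∅ ω)) P :=
    hbi.mul_bdd (c := 1) (by fun_prop) (Eventually.of_forall fun ω => hS.abs_le _)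
  have iug : Integrable (fun ω => U ∅ ω * g (b ω + U ∅ ω)) P :=
    hUi.mul_bdd (c := 1) (by fun_prop) (Eventually.of_forall fun ω => hS.abs_le _)
  have iadd : Integrable (fun ω => b ω * g (b ω + U ∅ ω) + U ∅ ω * g (b ω + U ∅ ω)) P :=
    ibg.add iug
  have iTg : Integrable (fun ω => exchangeT U ω * g' (b ω + U ∅ ω)) P :=
    (hT.integrable (by norm_num)).mul_bdd (by fun_prop)
      (Eventually.of_forall fun ω => hS.abs_deriv_le _)
  have hsplit : ∫ ω, (K * g' (V ω) - V ω * g (V ω)) ∂P =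
      K * (∫ ω, g' (b ω + U ∅ ω) ∂P) - ((∫ ω, b ω * g (b ω + U ∅ ω) ∂P) +
        ∫ ω, U ∅ ω * g (b ω + U ∅ ω) ∂P) := by
    rw [← integral_add ibg iug, ← integral_const_mul, ← integral_sub (ig'.const_mul K)
      iadd]
    simp only [hVU, add_mul]
  have hsplit2 : ∫ ω, (K - Cb - exchangeT U ω) * g' (V ω) ∂P =
      (K - Cb) * (∫ ω, g' (b ω + U ∅ ω) ∂P) - ∫ ω, exchangeT U ω * g' (b ω + U ∅ ω) ∂P := by
    rw [← integral_const_mul, ← integral_sub (ig'.const_mul _) iTg]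
    simp only [hVU, sub_mul]
  set m := MeasurableSpace.comap V inferInstance with hm
  have hmle : m ≤ mΩ := hVm.comap_le
  have hgV : StronglyMeasurable[m] fun ω => g' (V ω) :=
    (hgc'.measurable.comp (comap_measurable V)).stronglyMeasurable
  -- Since `g' (V)` is measurable with respect to `V`, the other factor may be replaced by its
  -- conditional expectation before Cauchy–Schwarz.
  have hcond : ∫ ω, (K - Cb - exchangeT U ω) * g' (V ω) ∂P =
      ∫ ω, (P[fun ω' => K - Cb - exchangeT U ω' | m]) ω * g' (V ω) ∂P := by
    have hi : Integrable (fun ω => (K - Cb - exchangeT U ω) * g' (V ω)) P :=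
      hSi.mul_bdd (by fun_prop) (Eventually.of_forall fun ω => hS.abs_deriv_le _)
    refine (integral_condExp hmle).symm.trans ?_
    exact integral_congr_ae (condExp_mul_of_stronglyMeasurable_right hgV hi hSi)
  have hfin := abs_integral_mul_le_sqrt (hS2.condExp (m := m) (by norm_num))
    (Real.sqrt_nonneg (2 / (K * Real.pi))) (fun ω => hS.abs_deriv_le (V ω))
  rw [← hcond] at hfin
  rw [hsplit, hbias]
  linarith

end Resampling

/-! ### Comparison of third and fourth moments. -/

section Moments

/-- Jensen's inequality for the convex function `t ↦ t ^ (4/3)`. -/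
theorem integral_abs_pow_three_le {Ω : Type*} [MeasurableSpace Ω] {P : Measure Ω}
    [IsProbabilityMeasure P] {f : Ω → ℝ} (hf : MemLp f 4 P) :
    ∫ ω, |f ω| ^ 3 ∂P ≤ (∫ ω, f ω ^ 4 ∂P) ^ (3 / 4 : ℝ) := by
  have h4 : ∀ ω, (|f ω| ^ 3) ^ (4 / 3 : ℝ) = f ω ^ 4 := by
    intro ω
    rw [← Real.rpow_natCast (|f ω|) 3, ← Real.rpow_mul (abs_nonneg _)]
    norm_num
    exact Even.pow_abs (by decide) _
  have hi4 : Integrable (fun ω => f ω ^ 4) P := by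
    have := hf.integrable_norm_pow (p := 4) (by norm_num)
    simpa [Even.pow_abs (n := 4) (by decide)] using this
  have h := (convexOn_rpow (p := 4 / 3) (by norm_num)).map_integral_le (μ := P)
    (f := fun ω => |f ω| ^ 3)
    (Real.continuous_rpow_const (by norm_num)).continuousOn isClosed_Ici
    (Eventually.of_forall fun ω => by simp only [mem_Ici]; positivity)
    (integrable_abs_pow_three hf) (by simpa only [Function.comp_def, h4] using hi4)
  simp only [h4] at h
  have h0 : 0 ≤ ∫ ω, |f ω| ^ 3 ∂P := integral_nonneg fun ω => by positivity
  calc ∫ ω, |f ω| ^ 3 ∂P = ((∫ ω, |f ω| ^ 3 ∂P) ^ (4 / 3 : ℝ)) ^ (3 / 4 : ℝ) := by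
        rw [← Real.rpow_mul h0]
        norm_num
    _ ≤ _ := Real.rpow_le_rpow (by positivity) h (by norm_num)

end Moments

/-! ### Linear statistics with random coefficients. -/

section LinearStatistic

variable {Ω : Type*} [MeasurableSpace Ω] {P : Measure Ω} {k : ℕ}

/-- Centred independent weights with law `ν`, a Gaussian bias and random coefficients, each weight
and the bias being independent of everything else. -/
structure IsLinearSetup (P : Measure Ω) (Cb : ℝ) (ν : Measure ℝ) (b : Ω → ℝ)
    (W a : Fin k → Ω → ℝ) : Prop where
  mean_zero : ∫ w, w ∂ν = 0
  var_one : ∫ w, w ^ 2 ∂ν = 1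
  fourth : Integrable (fun w : ℝ => w ^ 4) ν
  measurable_b : Measurable b
  measurable_W : ∀ j, Measurable (W j)
  measurable_a : ∀ j, Measurable (a j)
  law_b : P.map b = gaussianReal 0 Cb.toNNReal
  law_W : ∀ j, P.map (W j) = ν
  memLp_a : ∀ j, MemLp (a j) 4 P
  indep_b : IndepFun b (fun ω => ((fun i => W i ω), (fun i => a i ω))) P
  indep_W : ∀ j, IndepFun (W j)
    (fun ω => (b ω, (fun i => if i = j then 0 else W i ω), (fun i => a i ω))) P

namespace IsLinearSetup

variable {Cb : ℝ} {ν : Measure ℝ} {b : Ω → ℝ} {W a : Fin k → Ω → ℝ}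

theorem integral_law (h : IsLinearSetup P Cb ν b W a) (j : Fin k) {f : ℝ → ℝ} (hf : Measurable f) :
    ∫ ω, f (W j ω) ∂P = ∫ w, f w ∂ν := by
  rw [← h.law_W j, integral_map (h.measurable_W j).aemeasurable hf.aestronglyMeasurable]

theorem memLp_W (h : IsLinearSetup P Cb ν b W a) (j : Fin k) : MemLp (W j) 4 P := by
  refine memLp_four_of_integrable (h.measurable_W j) ?_
  have := h.fourth
  rw [← h.law_W j] at this
  exact this.comp_measurable (h.measurable_W j)

theorem indepFun_a (h : IsLinearSetup P Cb ν b W a) (j : Fin k) : IndepFun (W j) (a j) P :=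
  (h.indep_W j).comp measurable_id
    (ψ := fun q : ℝ × (Fin k → ℝ) × (Fin k → ℝ) => q.2.2 j) (by fun_prop)

theorem memLp_mul (h : IsLinearSetup P Cb ν b W a) (j : Fin k) :
    MemLp (fun ω => a j ω * W j ω) 4 P := by
  refine memLp_four_of_integrable ((h.measurable_a j).mul (h.measurable_W j)) ?_
  have hpow : ∀ {f : Ω → ℝ}, MemLp f 4 P → Integrable (fun ω => f ω ^ 4) P := by
    intro f hf
    have := hf.integrable_norm_pow (p := 4) (by norm_num)
    simpa [Even.pow_abs (n := 4) (by decide)] using this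
  have hi := ((h.indepFun_a j).symm.comp (φ := fun x : ℝ => x ^ 4) (ψ := fun x : ℝ => x ^ 4)
    (by fun_prop) (by fun_prop)).integrable_mul (hpow (h.memLp_a j)) (hpow (h.memLp_W j))
  refine hi.congr (Eventually.of_forall fun ω => ?_)
  simp [mul_pow]

theorem memLp_sq_sub (h : IsLinearSetup P Cb ν b W a) (j : Fin k) :
    MemLp (fun ω => a j ω ^ 2 * (W j ω ^ 2 - 1)) 2 P := by
  have h1 := (memLp_two_mul (h.memLp_mul j) (h.memLp_mul j)).sub
    (memLp_two_mul (h.memLp_a j) (h.memLp_a j))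
  refine (memLp_congr_ae (Eventually.of_forall fun ω => ?_)).1 h1
  simp only [Pi.sub_apply]
  ring

variable [IsProbabilityMeasure P]

/-- The coefficients may depend on each other, but `W j` is independent of all of them together with
`W i`, and `W j ^ 2 - 1` has mean zero. -/
theorem integral_sq_sub_mul (h : IsLinearSetup P Cb ν b W a) {i j : Fin k} (hij : i ≠ j) :
    ∫ ω, (a i ω ^ 2 * (W i ω ^ 2 - 1)) * (a j ω ^ 2 * (W j ω ^ 2 - 1)) ∂P = 0 := by
  have hprob : IsProbabilityMeasure ν := h.law_W j ▸
    Measure.isProbabilityMeasure_map (h.measurable_W j).aemeasurable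
  have hi := (h.indep_W j).comp (φ := fun x : ℝ => x ^ 2 - 1)
    (ψ := fun q : ℝ × (Fin k → ℝ) × (Fin k → ℝ) => q.2.2 i ^ 2 * (q.2.1 i ^ 2 - 1) * q.2.2 j ^ 2)
    (by fun_prop) (by fun_prop)
  simp only [Function.comp_def, if_neg hij] at hi
  have h1 := hi.integral_fun_mul_eq_mul_integral
    (((h.measurable_W j).pow_const 2).sub_const 1).aestronglyMeasurable
    ((((h.measurable_a i).pow_const 2).mul (((h.measurable_W i).pow_const 2).sub_const 1)).mul
      ((h.measurable_a j).pow_const 2)).aestronglyMeasurable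
  have h2 : ∫ ω, (W j ω ^ 2 - 1) ∂P = 0 := by
    rw [h.integral_law j (f := fun w => w ^ 2 - 1) (by fun_prop), integral_sub _ (by simp),
      h.var_one]
    · simp
    -- A nonintegrable square would have integral `0` by convention, which contradicts unit
    -- variance.
    · by_contra hc
      have := h.var_one
      rw [integral_undef hc] at this
      norm_num at this
  rw [h2, zero_mul] at h1
  rw [← h1]
  congr with ω
  ring

theorem integral_sq_sub_sq (h : IsLinearSetup P Cb ν b W a) (j : Fin k) :
    ∫ ω, (a j ω ^ 2 * (W j ω ^ 2 - 1)) * (a j ω ^ 2 * (W j ω ^ 2 - 1)) ∂P =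
      (∫ ω, a j ω ^ 4 ∂P) * (∫ w, w ^ 4 ∂ν - 1) := by
  have hprob : IsProbabilityMeasure ν := h.law_W j ▸
    Measure.isProbabilityMeasure_map (h.measurable_W j).aemeasurable
  have hi := (h.indepFun_a j).comp (φ := fun x : ℝ => (x ^ 2 - 1) ^ 2) (ψ := fun x : ℝ => x ^ 4)
    (by fun_prop) (by fun_prop)
  simp only [Function.comp_def] at hi
  have hW := h.measurable_W j
  have ha := h.measurable_a j
  have h1 := hi.integral_fun_mul_eq_mul_integral (by fun_prop) (by fun_prop)
  have h2 : ∫ ω, (W j ω ^ 2 - 1) ^ 2 ∂P = ∫ w, w ^ 4 ∂ν - 1 := by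
    rw [h.integral_law j (f := fun w => (w ^ 2 - 1) ^ 2) (by fun_prop)]
    have i2 : Integrable (fun w : ℝ => w ^ 2) ν := by
      by_contra hc
      have := h.var_one
      rw [integral_undef hc] at this
      norm_num at this
    have : ∀ w : ℝ, (w ^ 2 - 1) ^ 2 = w ^ 4 - 2 * w ^ 2 + 1 := fun w => by ring
    simp only [this]
    have i3 : Integrable (fun w : ℝ => w ^ 4 - 2 * w ^ 2) ν := h.fourth.sub (i2.const_mul 2)
    rw [integral_add i3 (integrable_const 1), integral_sub h.fourth (i2.const_mul 2), integral_const_mul, h.var_one]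
    simp
    ring
  rw [h2, mul_comm] at h1
  rw [← h1]
  congr with ω
  ring

theorem integral_sum_sq_sub_sq (h : IsLinearSetup P Cb ν b W a) :
    ∫ ω, (∑ j, a j ω ^ 2 * (W j ω ^ 2 - 1)) ^ 2 ∂P =
      ∑ j, (∫ ω, a j ω ^ 4 ∂P) * (∫ w, w ^ 4 ∂ν - 1) := by
  have hint : ∀ i j, Integrable (fun ω =>
      (a i ω ^ 2 * (W i ω ^ 2 - 1)) * (a j ω ^ 2 * (W j ω ^ 2 - 1))) P := fun i j =>
    (h.memLp_sq_sub i).integrable_mul (h.memLp_sq_sub j)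
  simp only [pow_two (∑ j, _ : ℝ), Finset.sum_mul_sum]
  rw [integral_finsetSum _ fun i _ => integrable_finsetSum _ fun j _ => hint i j]
  refine Finset.sum_congr rfl fun i _ => ?_
  rw [integral_finsetSum _ fun j _ => hint i j, Finset.sum_eq_single i]
  · exact h.integral_sq_sub_sq i
  · exact fun j _ hj => h.integral_sq_sub_mul hj.symm
  · simp

/-- Removing the `j`-th summand from the argument of `g` leaves something independent of the centred
`W j`, so that term has mean zero. Taylor's formula at the full sum evaluates the difference. -/
theorem leaveOneOut_integral_mul_ge (h : IsLinearSetup P Cb ν b W a) {K : ℝ}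
    {g g' g'' : ℝ → ℝ} (hS : IsSteinFun K g g' g'') (j : Fin k) :
    (∫ ω, (a j ω * W j ω) ^ 2 * g' (b ω + ∑ i, a i ω * W i ω) ∂P) -
      1 / K * ((∫ ω, |a j ω| ^ 3 ∂P) * ∫ w, |w| ^ 3 ∂ν) ≤
      ∫ ω, a j ω * W j ω * g (b ω + ∑ i, a i ω * W i ω) ∂P := by
  have hgc := hS.continuous
  have hgc' := hS.continuous_deriv
  have hb := h.measurable_b
  have hW := h.measurable_W
  have ha := h.measurable_a
  set V : Ω → ℝ := fun ω => b ω + ∑ i, a i ω * W i ω with hV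
  have hVm : Measurable V := hb.add (Finset.measurable_sum _ fun i _ => (ha i).mul (hW i))
  have hVj : ∀ ω, b ω + ∑ i, a i ω * (if i = j then 0 else W i ω) = V ω - a j ω * W j ω := by
    intro ω
    have : ∀ i, a i ω * (if i = j then 0 else W i ω) =
        a i ω * W i ω - if i = j then a i ω * W i ω else 0 := by
      intro i
      split_ifs <;> ring
    simp only [this, Finset.sum_sub_distrib, Finset.sum_ite_eq', Finset.mem_univ, if_true, hV]
    ring
  have hzero : ∫ ω, a j ω * W j ω * g (V ω - a j ω * W j ω) ∂P = 0 := by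
    have hi := (h.indep_W j).comp (φ := id) (ψ := fun q : ℝ × (Fin k → ℝ) × (Fin k → ℝ) =>
      q.2.2 j * g (q.1 + ∑ i, q.2.2 i * q.2.1 i)) (by fun_prop) (by fun_prop)
    simp only [Function.comp_def, hVj, id] at hi
    have h1 := hi.integral_fun_mul_eq_mul_integral (by fun_prop) (by fun_prop)
    rw [h.integral_law j (f := fun w => w) measurable_id, h.mean_zero, zero_mul] at h1
    rw [← h1]
    congr with ω
    ring
  have hx := h.memLp_mul j
  have hxi : Integrable (fun ω => a j ω * W j ω) P := hx.integrable (by norm_num)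
  have i1 : Integrable (fun ω => a j ω * W j ω * g (V ω)) P :=
    hxi.mul_bdd (c := 1) (by fun_prop) (Eventually.of_forall fun ω => hS.abs_le _)
  have i2 : Integrable (fun ω => a j ω * W j ω * g (V ω - a j ω * W j ω)) P :=
    hxi.mul_bdd (c := 1) (by fun_prop) (Eventually.of_forall fun ω => hS.abs_le _)
  have i3 : Integrable (fun ω => (a j ω * W j ω) ^ 2 * g' (V ω)) P := by
    have := (memLp_two_mul hx hx).integrable (by norm_num)
    simp only [← pow_two] at this
    exact this.mul_bdd (by fun_prop) (Eventually.of_forall fun ω => hS.abs_deriv_le _)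
  have i4 := integrable_abs_pow_three hx
  have hthird : ∫ ω, |a j ω * W j ω| ^ 3 ∂P = (∫ ω, |a j ω| ^ 3 ∂P) * ∫ w, |w| ^ 3 ∂ν := by
    have hi := (h.indepFun_a j).symm.comp (φ := fun x : ℝ => |x| ^ 3) (ψ := fun x : ℝ => |x| ^ 3)
      (by fun_prop) (by fun_prop)
    simp only [Function.comp_def] at hi
    have h1 := hi.integral_fun_mul_eq_mul_integral (by fun_prop) (by fun_prop)
    rw [h.integral_law j (f := fun w => |w| ^ 3) (by fun_prop)] at h1
    simpa only [abs_mul, mul_pow] using h1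
  have hle : ∫ ω, ((a j ω * W j ω) ^ 2 * g' (V ω) - 1 / K * |a j ω * W j ω| ^ 3) ∂P ≤
      ∫ ω, (a j ω * W j ω * g (V ω) - a j ω * W j ω * g (V ω - a j ω * W j ω)) ∂P := by
    refine integral_mono (i3.sub (i4.const_mul _)) (i1.sub i2) fun ω => ?_
    simp only
    set y := a j ω * W j ω
    have ht := hS.abs_taylor_le (V ω) (V ω - y)
    rw [sub_sub_cancel] at ht
    have hprod : |y * (g (V ω) - g (V ω - y) - g' (V ω) * y)| ≤ 1 / K * |y| ^ 3 := by
      rw [abs_mul]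
      calc _ ≤ |y| * (1 / K * y ^ 2) := by gcongr
        _ = _ := by
          rw [← sq_abs]
          ring
    have := (abs_le.1 hprod).1
    nlinarith
  rw [integral_sub i3 (i4.const_mul _), integral_sub i1 i2, integral_const_mul, hzero, sub_zero,
    hthird] at hle
  exact hle

/-- Normal approximation of a linear statistic with random coefficients and a Gaussian bias. -/
theorem wassersteinOne_le (h : IsLinearSetup P Cb ν b W a) (hCb : 0 ≤ Cb) {K : ℝ} (hK : 0 < K) :
    wassersteinOne (P.map fun ω => b ω + ∑ j, a j ω * W j ω) (gaussianReal 0 K.toNNReal) ≤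
      ENNReal.ofReal (√(2 / (K * Real.pi)) * (√(∫ ω, (K - Cb - ∑ j, a j ω ^ 2) ^ 2 ∂P) +
          √(∑ j, (∫ ω, a j ω ^ 4 ∂P) * (∫ w, w ^ 4 ∂ν - 1))) +
        1 / K * ∑ j, (∫ ω, |a j ω| ^ 3 ∂P) * ∫ w, |w| ^ 3 ∂ν) := by
  have hb := h.measurable_b
  have hW := h.measurable_W
  have ha := h.measurable_a
  set F : Ω → ℝ := fun ω => ∑ i, a i ω * W i ω with hF
  have hFm : Measurable F := Finset.measurable_sum _ fun i _ => (ha i).mul (hW i)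
  have hbi : Integrable b P := by
    have := Stein.integrable_id_gaussianReal Cb.toNNReal
    rw [← h.law_b] at this
    exact this.comp_measurable hb
  have hxi : ∀ j, Integrable (fun ω => a j ω * W j ω) P := fun j =>
    (h.memLp_mul j).integrable (by norm_num)
  have hFi : Integrable F P := integrable_finsetSum _ fun j _ => hxi j
  have hbF : IndepFun b F P := h.indep_b.comp measurable_id
    (ψ := fun q : (Fin k → ℝ) × (Fin k → ℝ) => ∑ i, q.2 i * q.1 i) (by fun_prop)
  refine wassersteinOne_gaussianReal_le (V := fun ω => b ω + F ω) (hb.add hFm) (hbi.add hFi) hK fun g g' g'' hS => ?_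
  have hgc := hS.continuous
  have hgc' := hS.continuous_deriv
  have hbias := integral_bias_mul hb hFm h.law_b hbF hS
  rw [Real.coe_toNNReal _ hCb] at hbias
  have ig' : Integrable (fun ω => g' (b ω + F ω)) P :=
    Integrable.of_bound (by fun_prop) _ (Eventually.of_forall fun ω => hS.abs_deriv_le _)
  have ibg : Integrable (fun ω => b ω * g (b ω + F ω)) P :=
    hbi.mul_bdd (c := 1) (by fun_prop) (Eventually.of_forall fun ω => hS.abs_le _)
  have ixg : ∀ j, Integrable (fun ω => a j ω * W j ω * g (b ω + F ω)) P := fun j =>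
    (hxi j).mul_bdd (c := 1) (by fun_prop) (Eventually.of_forall fun ω => hS.abs_le _)
  have isum : Integrable (fun ω => ∑ j, a j ω * W j ω * g (b ω + F ω)) P :=
    integrable_finsetSum _ fun j _ => ixg j
  have iadd : Integrable (fun ω => b ω * g (b ω + F ω) + ∑ j, a j ω * W j ω * g (b ω + F ω)) P :=
    ibg.add isum
  have hsplit : ∫ ω, (K * g' (b ω + F ω) - (b ω + F ω) * g (b ω + F ω)) ∂P =
      K * (∫ ω, g' (b ω + F ω) ∂P) - ((∫ ω, b ω * g (b ω + F ω) ∂P) +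
        ∑ j, ∫ ω, a j ω * W j ω * g (b ω + F ω) ∂P) := by
    rw [← integral_finsetSum _ fun j _ => ixg j, ← integral_add ibg isum, ← integral_const_mul,
      ← integral_sub (ig'.const_mul K) iadd]
    simp only [add_mul, ← Finset.sum_mul, hF]
  have hY : MemLp (fun ω => K - Cb - ∑ j, a j ω ^ 2) 2 P := by
    refine (memLp_const _).sub (memLp_finsetSum _ fun j _ => ?_)
    simpa only [pow_two] using memLp_two_mul (h.memLp_a j) (h.memLp_a j)
  have hZ : MemLp (fun ω => -∑ j, a j ω ^ 2 * (W j ω ^ 2 - 1)) 2 P :=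
    (memLp_finsetSum _ fun j _ => h.memLp_sq_sub j).neg
  have e1 := abs_integral_mul_le_sqrt hY (Real.sqrt_nonneg (2 / (K * Real.pi)))
    (fun ω => hS.abs_deriv_le (b ω + F ω))
  have e2 := abs_integral_mul_le_sqrt hZ (Real.sqrt_nonneg (2 / (K * Real.pi)))
    (fun ω => hS.abs_deriv_le (b ω + F ω))
  simp only [neg_sq, h.integral_sum_sq_sub_sq] at e2
  have iYg : Integrable (fun ω => (K - Cb - ∑ j, a j ω ^ 2) * g' (b ω + F ω)) P :=
    (hY.integrable (by norm_num)).mul_bdd (by fun_prop)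
      (Eventually.of_forall fun ω => hS.abs_deriv_le _)
  have iZg : Integrable (fun ω => (-∑ j, a j ω ^ 2 * (W j ω ^ 2 - 1)) * g' (b ω + F ω)) P :=
    (hZ.integrable (by norm_num)).mul_bdd (by fun_prop)
      (Eventually.of_forall fun ω => hS.abs_deriv_le _)
  have ixg' : ∀ j, Integrable (fun ω => (a j ω * W j ω) ^ 2 * g' (b ω + F ω)) P := by
    intro j
    have := (memLp_two_mul (h.memLp_mul j) (h.memLp_mul j)).integrable (by norm_num)
    simp only [← pow_two] at this
    exact this.mul_bdd (by fun_prop) (Eventually.of_forall fun ω => hS.abs_deriv_le _)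
  -- Writing `W_j² = 1 + (W_j² - 1)` separates the fluctuation of the conditional variance from an
  -- orthogonal sum.
  have hsplit2 : (K - Cb) * (∫ ω, g' (b ω + F ω) ∂P) -
      ∑ j, ∫ ω, (a j ω * W j ω) ^ 2 * g' (b ω + F ω) ∂P =
      (∫ ω, (K - Cb - ∑ j, a j ω ^ 2) * g' (b ω + F ω) ∂P) +
        ∫ ω, (-∑ j, a j ω ^ 2 * (W j ω ^ 2 - 1)) * g' (b ω + F ω) ∂P := by
    rw [← integral_add iYg iZg, ← integral_finsetSum _ fun j _ => ixg' j, ← integral_const_mul,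
      ← integral_sub (ig'.const_mul _) (integrable_finsetSum _ fun j _ => ixg' j)]
    congr with ω
    simp only [mul_sub, mul_one, Finset.sum_sub_distrib, ← Finset.sum_mul, mul_pow]
    ring
  have hsum := Finset.sum_le_sum fun j (_ : j ∈ Finset.univ) =>
    h.leaveOneOut_integral_mul_ge hS j
  rw [Finset.sum_sub_distrib, ← Finset.mul_sum] at hsum
  rw [hsplit, hbias, mul_add]
  linarith

end IsLinearSetup

end LinearStatistic

/-! ### Independence of disjoint groups of parameters. -/

section SigmaAlgebras

variable {Ω ι α β : Type*} {mΩ : MeasurableSpace Ω} {P : Measure Ω} {mα : MeasurableSpace α}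
  {mβ : MeasurableSpace β}

/-- The `σ`-algebra generated by the members of a real family with index in `S`. -/
@[reducible]
def generatedBy (X : ι → Ω → ℝ) (S : Set ι) : MeasurableSpace Ω :=
  ⨆ i ∈ S, MeasurableSpace.comap (X i) inferInstance

theorem measurable_pi_of_forall {m : MeasurableSpace Ω} {f : Ω → ι → ℝ}
    (h : ∀ i, Measurable[m] fun ω => f ω i) : Measurable[m] f :=
  measurable_pi_lambda _ h

theorem generatedBy_mono (X : ι → Ω → ℝ) {S T : Set ι} (h : S ⊆ T) :
    generatedBy X S ≤ generatedBy X T :=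
  biSup_mono h

theorem measurable_generatedBy (X : ι → Ω → ℝ) {S : Set ι} {i : ι} (hi : i ∈ S) :
    Measurable[generatedBy X S] (X i) :=
  Measurable.mono (comap_measurable (X i))
    (le_biSup (fun i => MeasurableSpace.comap (X i) inferInstance) hi) le_rfl

theorem ProbabilityTheory.iIndepFun.indepFun_of_measurable_generatedBy {X : ι → Ω → ℝ}
    (h : iIndepFun X P) (hX : ∀ i, Measurable (X i)) {S T : Set ι} (hST : Disjoint S T)
    {f : Ω → α} {g : Ω → β} (hf : Measurable[generatedBy X S] f)
    (hg : Measurable[generatedBy X T] g) : IndepFun f g P := by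
  rw [IndepFun_iff_Indep]
  have hind := indep_iSup_of_disjoint (fun i => (hX i).comap_le) h.iIndep hST
  exact indep_of_indep_of_le_left (indep_of_indep_of_le_right hind hg.comap_le) hf.comap_le

end SigmaAlgebras

/-! ### Measurability, independence and equality in law inside the network. -/

section Network

variable {Ω : Type*} {σ : ℝ → ℝ} {Cb CW : ℝ} {n : ℕ → ℕ}
  {W : (ℓ : ℕ) → Fin (n (ℓ + 1)) → Fin (n ℓ) → Ω → ℝ} {b : (ℓ : ℕ) → Fin (n (ℓ + 1)) → Ω → ℝ}
  {x : Fin (n 0) → ℝ} {L : ℕ}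

/-- The layer from which the weight or bias with a given index leads. -/
def ParamIndex.layer : ParamIndex L n → ℕ
  | Sum.inl q => q.1
  | Sum.inr q => q.1

/-- The index of a weight. -/
def weightIdx {ℓ : ℕ} (hℓ : ℓ ≤ L) (j : Fin (n (ℓ + 1))) (k : Fin (n ℓ)) : ParamIndex L n :=
  Sum.inl ⟨⟨ℓ, Nat.lt_succ_of_le hℓ⟩, j, k⟩

/-- The index of a bias. -/
def biasIdx {ℓ : ℕ} (hℓ : ℓ ≤ L) (j : Fin (n (ℓ + 1))) : ParamIndex L n :=
  Sum.inr ⟨⟨ℓ, Nat.lt_succ_of_le hℓ⟩, j⟩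

/-- The output of a layer that is fed into the next one. -/
noncomputable def activation (σ : ℝ → ℝ) (CW : ℝ) (n : ℕ → ℕ)
    (W : (ℓ : ℕ) → Fin (n (ℓ + 1)) → Fin (n ℓ) → Ω → ℝ)
    (b : (ℓ : ℕ) → Fin (n (ℓ + 1)) → Ω → ℝ) (x : Fin (n 0) → ℝ) :
    (ℓ : ℕ) → Fin (n ℓ) → Ω → ℝ
  | 0 => fun j _ => x j
  | ℓ + 1 => fun j ω => σ (preact σ CW n W b x (ℓ + 1) j ω)

/-- Since `activation` treats the raw input as the output of layer `0`, the first layer and the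
later ones obey one recursion. -/
theorem preact_succ (ℓ : ℕ) (j : Fin (n (ℓ + 1))) (ω : Ω) :
    preact σ CW n W b x (ℓ + 1) j ω = b ℓ j ω +
      √CW / √(n ℓ) * ∑ k, W ℓ j k ω * activation σ CW n W b x ℓ k ω := by
  cases ℓ <;> rfl

/-- Parameters leading from layer `ℓ` to `ℓ + 1` carry the index `ℓ`, so layer `ℓ` sees only
strictly smaller indices. All independence between activations and the next parameters rests on this
strict inequality. -/
theorem measurable_preact_generatedBy (hσ : Measurable σ) :
    ∀ ℓ ≤ L + 1, ∀ j, Measurable[generatedBy (params L n W b) {i | i.layer < ℓ}]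
      (preact σ CW n W b x ℓ j) := by
  intro ℓ
  induction ℓ with
  | zero => exact fun _ j => measurable_const
  | succ ℓ ih =>
    intro hℓ j
    have hℓ' : ℓ ≤ L := by omega
    have hb : Measurable[generatedBy (params L n W b) {i | i.layer < ℓ + 1}] (b ℓ j) :=
      measurable_generatedBy (params L n W b) (i := biasIdx hℓ' j) (Nat.lt_succ_self ℓ)
    have hW : ∀ k, Measurable[generatedBy (params L n W b) {i | i.layer < ℓ + 1}] (W ℓ j k) :=
      fun k => measurable_generatedBy (params L n W b) (i := weightIdx hℓ' j k) (Nat.lt_succ_self ℓ)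
    have ha : ∀ k, Measurable[generatedBy (params L n W b) {i | i.layer < ℓ + 1}]
        (activation σ CW n W b x ℓ k) := by
      intro k
      cases ℓ with
      | zero => exact measurable_const
      | succ m =>
        exact hσ.comp ((ih (by omega) k).mono
          (generatedBy_mono _ fun i (hi : i.layer < m + 1) => Nat.lt_succ_of_lt hi) le_rfl)
    have h := hb.add (measurable_const (a := √CW / √(n ℓ)) |>.mul
      (Finset.measurable_fun_sum Finset.univ fun k _ => (hW k).mul (ha k)))
    rw [show preact σ CW n W b x (ℓ + 1) j = _ from funext fun ω => preact_succ ℓ j ω]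
    exact h

theorem measurable_activation_generatedBy (hσ : Measurable σ) {ℓ : ℕ} (hℓ : ℓ ≤ L) (j) :
    Measurable[generatedBy (params L n W b) {i | i.layer < ℓ}] (activation σ CW n W b x ℓ j) := by
  cases ℓ with
  | zero => exact measurable_const
  | succ m => exact hσ.comp (measurable_preact_generatedBy hσ _ (by omega) j)

theorem measurable_weight_generatedBy {ℓ : ℕ} (hℓ : ℓ ≤ L) (j k) {S : Set (ParamIndex L n)}
    (hS : weightIdx hℓ j k ∈ S) : Measurable[generatedBy (params L n W b) S] (W ℓ j k) :=
  measurable_generatedBy (params L n W b) hS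

theorem measurable_bias_generatedBy {ℓ : ℕ} (hℓ : ℓ ≤ L) (j) {S : Set (ParamIndex L n)}
    (hS : biasIdx hℓ j ∈ S) : Measurable[generatedBy (params L n W b) S] (b ℓ j) :=
  measurable_generatedBy (params L n W b) hS

variable [mΩ : MeasurableSpace Ω] {P : Measure Ω} {ν : Measure ℝ}

namespace IsRandomInit

theorem measurable_params (h : IsRandomInit P L n Cb ν W b) (i : ParamIndex L n) :
    Measurable (params L n W b i) := by
  rcases i with ⟨ℓ, j, k⟩ | ⟨ℓ, j⟩
  · exact h.measurable_weight ℓ (Nat.le_of_lt_succ ℓ.2) j k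
  · exact h.measurable_bias ℓ (Nat.le_of_lt_succ ℓ.2) j

theorem generatedBy_le (h : IsRandomInit P L n Cb ν W b) (S : Set (ParamIndex L n)) :
    generatedBy (params L n W b) S ≤ mΩ :=
  iSup₂_le fun i _ => (h.measurable_params i).comap_le

theorem measurable_activation (h : IsRandomInit P L n Cb ν W b) (hσ : Measurable σ) {ℓ : ℕ}
    (hℓ : ℓ ≤ L) (j) : Measurable (activation σ CW n W b x ℓ j) :=
  (measurable_activation_generatedBy hσ hℓ j).mono (h.generatedBy_le _) le_rfl

theorem indepFun_bias (h : IsRandomInit P L n Cb ν W b) (hσ : Measurable σ) {ℓ : ℕ} (hℓ : ℓ ≤ L)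
    (j) : IndepFun (b ℓ j)
      (fun ω => ((fun k => W ℓ j k ω), (fun k => activation σ CW n W b x ℓ k ω))) P := by
  refine h.indep.indepFun_of_measurable_generatedBy h.measurable_params
    (S := {biasIdx hℓ j}) (T := {biasIdx hℓ j}ᶜ) disjoint_compl_right
    (measurable_bias_generatedBy hℓ j rfl) ?_
  refine Measurable.prodMk (measurable_pi_of_forall fun k => ?_) (measurable_pi_of_forall fun k => ?_)
  · exact measurable_weight_generatedBy hℓ j k (by simp [weightIdx, biasIdx])
  · refine (measurable_activation_generatedBy hσ hℓ k).mono (generatedBy_mono _ ?_) le_rfl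
    rintro i (hi : i.layer < ℓ) rfl
    exact lt_irrefl _ hi

theorem indepFun_weight (h : IsRandomInit P L n Cb ν W b) (hσ : Measurable σ) {ℓ : ℕ} (hℓ : ℓ ≤ L)
    (j k) : IndepFun (W ℓ j k) (fun ω => (b ℓ j ω, (fun i => if i = k then 0 else W ℓ j i ω),
      (fun i => activation σ CW n W b x ℓ i ω))) P := by
  refine h.indep.indepFun_of_measurable_generatedBy h.measurable_params
    (S := {weightIdx hℓ j k}) (T := {weightIdx hℓ j k}ᶜ) disjoint_compl_right
    (measurable_weight_generatedBy hℓ j k rfl) ?_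
  refine Measurable.prodMk ?_ (Measurable.prodMk (measurable_pi_of_forall fun i => ?_)
    (measurable_pi_of_forall fun i => ?_))
  · exact measurable_bias_generatedBy hℓ j (by simp [weightIdx, biasIdx])
  · by_cases hi : i = k
    · simp only [hi, if_true]
      exact measurable_const
    · simp only [hi, if_false]
      exact measurable_weight_generatedBy hℓ j i (by simpa [weightIdx] using hi)
  · refine (measurable_activation_generatedBy hσ hℓ i).mono (generatedBy_mono _ ?_) le_rfl
    rintro i (hi : i.layer < ℓ) rfl
    exact lt_irrefl _ hi

theorem indepFun_row (h : IsRandomInit P L n Cb ν W b) (hσ : Measurable σ) {ℓ : ℕ} (hℓ : ℓ ≤ L)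
    (j) : IndepFun (fun ω k => W ℓ j k ω) (fun ω k => activation σ CW n W b x ℓ k ω) P := by
  refine h.indep.indepFun_of_measurable_generatedBy h.measurable_params
    (S := {i | i.layer = ℓ}) (T := {i | i.layer < ℓ}) ?_
    (measurable_pi_of_forall fun k => ?_) (measurable_pi_of_forall fun k => ?_)
  · rw [Set.disjoint_left]
    rintro i (hi : i.layer = ℓ) (hi' : i.layer < ℓ)
    omega
  · exact measurable_weight_generatedBy hℓ j k rfl
  · exact measurable_activation_generatedBy hσ hℓ k

variable [IsProbabilityMeasure P]

/-- Given the previous layer, a neuron is a fixed function of its own bias and its own row of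
weights, whose joint law with that layer is a product that does not depend on the neuron. -/
theorem identDistrib_preact (h : IsRandomInit P L n Cb ν W b) (hσ : Measurable σ) {ℓ : ℕ}
    (hℓ : ℓ ≤ L) (i j) : IdentDistrib (preact σ CW n W b x (ℓ + 1) i)
      (preact σ CW n W b x (ℓ + 1) j) P P := by
  have ha : Measurable fun ω k => activation σ CW n W b x ℓ k ω :=
    measurable_pi_lambda _ fun k => h.measurable_activation hσ hℓ k
  have hW : ∀ j, Measurable fun ω k => W ℓ j k ω := fun j =>
    measurable_pi_lambda _ fun k => h.measurable_weight ℓ hℓ j k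
  have hlaw : ∀ j, P.map (fun ω => (b ℓ j ω, ((fun k => W ℓ j k ω),
      (fun k => activation σ CW n W b x ℓ k ω)))) = (gaussianReal 0 Cb.toNNReal).prod
      ((Measure.pi fun _ => ν).prod (P.map fun ω k => activation σ CW n W b x ℓ k ω)) := by
    intro j
    have hind : iIndepFun (fun k => W ℓ j k) P :=
      h.indep.precomp (g := fun k => weightIdx hℓ j k) (fun k k' hk => by
        simpa [weightIdx] using hk)
    rw [(indepFun_iff_map_prod_eq_prod_map_map (h.measurable_bias ℓ hℓ j).aemeasurable
      ((hW j).prodMk ha).aemeasurable).1 (h.indepFun_bias hσ hℓ j), h.law_bias ℓ hℓ,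
      (indepFun_iff_map_prod_eq_prod_map_map (hW j).aemeasurable ha.aemeasurable).1
      (h.indepFun_row hσ hℓ j),
      hind.map_fun_eq_pi_map fun k => (h.measurable_weight ℓ hℓ j k).aemeasurable]
    simp only [h.law_weight ℓ hℓ]
  have hm : ∀ j, Measurable fun ω => (b ℓ j ω, ((fun k => W ℓ j k ω),
      (fun k => activation σ CW n W b x ℓ k ω))) := fun j =>
    (h.measurable_bias ℓ hℓ j).prodMk ((hW j).prodMk ha)
  have hid : IdentDistrib _ _ P P := ⟨(hm i).aemeasurable, (hm j).aemeasurable,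
    (hlaw i).trans (hlaw j).symm⟩
  have := hid.comp (u := fun q : ℝ × (Fin (n ℓ) → ℝ) × (Fin (n ℓ) → ℝ) =>
    q.1 + √CW / √(n ℓ) * ∑ k, q.2.1 k * q.2.2 k) (by fun_prop)
  simpa only [Function.comp_def, ← preact_succ] using this

end IsRandomInit

end Network

/-! ### Constants and the network bound. -/

section NetworkBound

/-- In terms of the fourth roots `v` of `m` and `u` of `s`, it suffices that `3/2 u² ≤ u³ + 1` and
`2 √(v⁴ - 1) ≤ 3/2 v³`. -/
theorem two_mul_sqrt_le {m s : ℝ} (hm : 1 ≤ m) (hs : 0 ≤ s) :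
    2 * √(s * (m - 1)) ≤ m ^ (3 / 4 : ℝ) * (s ^ (3 / 4 : ℝ) + 1) := by
  have hm0 : 0 ≤ m := by linarith
  have key : ∀ y : ℝ, 0 ≤ y → ∃ u, 0 ≤ u ∧ u ^ 4 = y ∧ y ^ (3 / 4 : ℝ) = u ^ 3 := by
    intro y hy
    refine ⟨y ^ (1 / 4 : ℝ), by positivity, ?_, ?_⟩
    · rw [← Real.rpow_natCast, ← Real.rpow_mul hy]
      norm_num
    · rw [← Real.rpow_natCast, ← Real.rpow_mul hy]
      norm_num
  obtain ⟨v, hv, hv4, hv3⟩ := key m hm0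
  obtain ⟨u, hu, hu4, hu3⟩ := key s hs
  rw [hv3, hu3]
  have h1 : 3 / 2 * u ^ 2 ≤ u ^ 3 + 1 := by
    nlinarith [mul_nonneg (sq_nonneg (u - 1)) hu, sq_nonneg (u - 1)]
  have h2 : 2 * √(m - 1) ≤ 3 / 2 * v ^ 3 := by
    have : √(m - 1) ≤ 3 / 4 * v ^ 3 := by
      refine Real.sqrt_le_iff.2 ⟨by positivity, ?_⟩
      rw [← hv4]
      have hy : 0 ≤ v ^ 2 := sq_nonneg v
      -- With `y = v²` the claim is `9/16 y³ - y² + 1 ≥ 0`; the cubic has its minimum at `y =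
      -- 32/27`, close to `6/5`.
      nlinarith [mul_nonneg (sq_nonneg (v ^ 2 - 6 / 5)) hy, sq_nonneg (v ^ 2 - 6 / 5)]
    linarith
  have h3 : √(s * (m - 1)) = u ^ 2 * √(m - 1) := by
    rw [Real.sqrt_mul hs, ← hu4, show u ^ 4 = (u ^ 2) ^ 2 by ring, Real.sqrt_sq (by positivity)]
  rw [h3]
  calc 2 * (u ^ 2 * √(m - 1)) = u ^ 2 * (2 * √(m - 1)) := by ring
    _ ≤ u ^ 2 * (3 / 2 * v ^ 3) := by gcongr
    _ = v ^ 3 * (3 / 2 * u ^ 2) := by ring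
    _ ≤ _ := by gcongr

/-- The orthogonal sum accounts for `1 / √(2π)` through `two_mul_sqrt_le`. The third-moment term
needs only `√C / √K`, so the factor `4` is slack. -/
theorem network_constants_le {C N K m s q m3 s3 : ℝ} (hC : 0 < C) (hN : 0 < N) (hK : 0 < K)
    (hm : 1 ≤ m) (hs : 0 ≤ s) (hm3 : m3 ≤ m ^ (3 / 4 : ℝ))
    (hs3 : s3 ≤ s ^ (3 / 4 : ℝ)) (hs3' : 0 ≤ s3) :
    √(2 / (K * Real.pi)) * (q + √(N * ((√C / √N) ^ 4 * s * (m - 1)))) +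
      1 / K * (N * ((√C / √N) ^ 3 * s3 * m3)) ≤
      C / (√N * √K) * m ^ (3 / 4 : ℝ) * (s ^ (3 / 4 : ℝ) + 1) *
        (4 * √C / √K + 1 / √(2 * Real.pi)) + √(2 / (K * Real.pi)) * q := by
  have hpi := Real.pi_pos
  have hm0 : 0 ≤ m := by linarith
  have e1 : √(2 / (K * Real.pi)) = 2 / (√K * √(2 * Real.pi)) := by
    rw [← Real.sqrt_mul hK.le, eq_div_iff (by positivity), ← Real.sqrt_mul (by positivity),
      show 2 / (K * Real.pi) * (K * (2 * Real.pi)) = 2 ^ 2 by field_simp,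
      Real.sqrt_sq (by norm_num)]
  have e2 : √(N * ((√C / √N) ^ 4 * s * (m - 1))) = C / √N * √(s * (m - 1)) := by
    have h4 : N * ((√C / √N) ^ 4 * s * (m - 1)) = (C / √N) ^ 2 * (s * (m - 1)) := by
      have hC2 : √C ^ 2 = C := Real.sq_sqrt hC.le
      have hN2 : √N ^ 2 = N := Real.sq_sqrt hN.le
      rw [div_pow, div_pow, show √C ^ 4 = (√C ^ 2) ^ 2 by ring,
        show √N ^ 4 = (√N ^ 2) ^ 2 by ring, hC2, hN2]
      field_simp
    rw [h4, Real.sqrt_mul (by positivity), Real.sqrt_sq (by positivity)]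
  have e3 : 1 / K * (N * ((√C / √N) ^ 3 * s3 * m3)) = C / (√N * √K) * m3 * s3 * (√C / √K) := by
    have hC2 : √C * √C = C := Real.mul_self_sqrt hC.le
    have hN2 : √N * √N = N := Real.mul_self_sqrt hN.le
    have hK2 : √K * √K = K := Real.mul_self_sqrt hK.le
    have hN' : √N ≠ 0 := by positivity
    have hK' : √K ≠ 0 := by positivity
    generalize √C = c at *
    generalize √N = p at *
    generalize √K = r at *
    subst hC2 hN2 hK2
    field_simp
  have hfirst := two_mul_sqrt_le hm hs
  have hA : 2 / (√K * √(2 * Real.pi)) * (C / √N * √(s * (m - 1))) ≤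
      C / (√N * √K) * m ^ (3 / 4 : ℝ) * (s ^ (3 / 4 : ℝ) + 1) * (1 / √(2 * Real.pi)) := by
    calc _ = C / (√N * √K) * (2 * √(s * (m - 1))) * (1 / √(2 * Real.pi)) := by
          field_simp
      _ ≤ C / (√N * √K) * (m ^ (3 / 4 : ℝ) * (s ^ (3 / 4 : ℝ) + 1)) * (1 / √(2 * Real.pi)) := by
          gcongr
      _ = _ := by ring
  have hB : C / (√N * √K) * m3 * s3 * (√C / √K) ≤
      C / (√N * √K) * m ^ (3 / 4 : ℝ) * (s ^ (3 / 4 : ℝ) + 1) * (4 * √C / √K) := by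
    calc _ ≤ C / (√N * √K) * m ^ (3 / 4 : ℝ) * (s ^ (3 / 4 : ℝ) + 1) * (1 * √C / √K) := by
          rw [one_mul]
          gcongr
          linarith
      _ ≤ _ := by
          gcongr
          norm_num
  rw [e3, e2, mul_add, e1]
  linarith [hA, hB]

variable {Ω : Type*} [mΩ : MeasurableSpace Ω] {P : Measure Ω}
  {σ : ℝ → ℝ} {Cb CW : ℝ} {n : ℕ → ℕ} [∀ ℓ, NeZero (n ℓ)]
  {W : (ℓ : ℕ) → Fin (n (ℓ + 1)) → Fin (n ℓ) → Ω → ℝ} {b : (ℓ : ℕ) → Fin (n (ℓ + 1)) → Ω → ℝ}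
  {x : Fin (n 0) → ℝ} {L : ℕ} {ν : Measure ℝ}

theorem limitVar_nonneg (hCb : 0 ≤ Cb) (hCW : 0 ≤ CW) (ℓ : ℕ) :
    0 ≤ limitVar P σ Cb CW n W b x ℓ := by
  match ℓ with
  | 0 => exact le_rfl
  | 1 => exact le_rfl
  | 2 => exact add_nonneg hCb (mul_nonneg hCW (integral_nonneg fun a => sq_nonneg _))
  | ℓ + 3 => exact add_nonneg hCb (mul_nonneg hCW (integral_nonneg fun a => sq_nonneg _))

variable [IsProbabilityMeasure P]

/-- Normal approximation of a network output at finite width. -/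
theorem wassersteinOne_preact_le (hCb : 0 ≤ Cb) (hCW : 0 < CW) (hσ : Measurable σ) {m : ℕ}
    (h : IsRandomInit P (m + 1) n Cb ν W b) (h4 : Integrable (fun w : ℝ => w ^ 4) ν)
    (hσ4 : Integrable (fun ω => |σ (preact σ CW n W b x (m + 1) 0 ω)| ^ 4) P)
    (hK : limitVar P σ Cb CW n W b x (m + 2) ≠ 0) :
    wassersteinOne (P.map (preact σ CW n W b x (m + 2) 0))
      (gaussianReal 0 (limitVar P σ Cb CW n W b x (m + 2)).toNNReal) ≤
      ENNReal.ofReal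
        (CW / (√(n (m + 1)) * √(limitVar P σ Cb CW n W b x (m + 2))) *
            (∫ w, w ^ 4 ∂ν) ^ (3 / 4 : ℝ)
            * ((∫ ω, |σ (preact σ CW n W b x (m + 1) 0 ω)| ^ 4 ∂P) ^ (3 / 4 : ℝ) + 1)
            * (4 * √CW / √(limitVar P σ Cb CW n W b x (m + 2)) + 1 / √(2 * Real.pi))
          + √(2 / (limitVar P σ Cb CW n W b x (m + 2) * Real.pi)) *
            √(fluctuation P σ Cb CW n W b x 2 (m + 1))) := by
  set K := limitVar P σ Cb CW n W b x (m + 2) with hKdef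
  have hK0 : 0 < K := lt_of_le_of_ne (limitVar_nonneg hCb hCW.le _) hK.symm
  set s : Fin (n (m + 1)) → Ω → ℝ := fun k ω => σ (preact σ CW n W b x (m + 1) k ω) with hs
  have hN : 0 < (n (m + 1) : ℝ) := by
    exact_mod_cast Nat.pos_of_ne_zero (NeZero.ne (n (m + 1)))
  set c : ℝ := √CW / √(n (m + 1)) with hc
  have hsm : ∀ k, Measurable (s k) := fun k => h.measurable_activation hσ le_rfl k
  have hid : ∀ k, IdentDistrib (s k) (s 0) P P := fun k =>
    (h.identDistrib_preact hσ (Nat.le_succ m) k 0).comp hσ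
  have habs : ∀ t : ℝ, |t| ^ 4 = t ^ 4 := Even.pow_abs (by decide)
  simp only [habs] at hσ4 ⊢
  have hs0 : MemLp (s 0) 4 P := memLp_four_of_integrable (hsm 0) hσ4
  have hsL : ∀ k, MemLp (s k) 4 P := fun k => (hid k).memLp_iff.2 hs0
  have hsetup : IsLinearSetup P Cb ν (b (m + 1) 0) (W (m + 1) 0) (fun k ω => c * s k ω) := by
    refine ⟨h.mean_zero, h.var_one, h4, h.measurable_bias _ le_rfl _,
      h.measurable_weight _ le_rfl _, fun k => (hsm k).const_mul c, h.law_bias _ le_rfl _,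
      h.law_weight _ le_rfl _, fun k => (hsL k).const_mul c, ?_, fun k => ?_⟩
    · exact (h.indepFun_bias hσ le_rfl 0).comp measurable_id
        (ψ := fun q : (Fin (n (m + 1)) → ℝ) × (Fin (n (m + 1)) → ℝ) => (q.1, fun k => c * q.2 k))
        (by fun_prop)
    · exact (h.indepFun_weight hσ le_rfl 0 k).comp measurable_id
        (ψ := fun q : ℝ × (Fin (n (m + 1)) → ℝ) × (Fin (n (m + 1)) → ℝ) =>
          (q.1, q.2.1, fun k => c * q.2.2 k)) (by fun_prop)
  have hV : preact σ CW n W b x (m + 2) 0 =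
      fun ω => b (m + 1) 0 ω + ∑ k, c * s k ω * W (m + 1) 0 k ω := by
    ext ω
    rw [preact_succ, Finset.mul_sum]
    congr 1
    refine Finset.sum_congr rfl fun k _ => ?_
    simp only [hs, hc, activation]
    ring
  have hprob : IsProbabilityMeasure ν := h.law_weight (m + 1) le_rfl 0 0 ▸
    Measure.isProbabilityMeasure_map (h.measurable_weight _ le_rfl 0 0).aemeasurable
  have hν4 : MemLp (fun w : ℝ => w) 4 ν := memLp_four_of_integrable measurable_id h4
  -- The variance of `w²` is nonnegative and its mean is `1`.
  have hm1 : 1 ≤ ∫ w, w ^ 4 ∂ν := by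
    have h2 : MemLp (fun w : ℝ => w ^ 2) 2 ν := by
      simpa only [pow_two] using memLp_two_mul hν4 hν4
    have hvar := variance_nonneg (fun w : ℝ => w ^ 2) ν
    rw [variance_eq_sub h2, h.var_one] at hvar
    have e : ∫ w, ((fun w : ℝ => w ^ 2) ^ 2) w ∂ν = ∫ w, w ^ 4 ∂ν := by
      congr with w
      simp only [Pi.pow_apply]
      ring
    rw [e] at hvar
    linarith
  have hsum4 : ∑ k, (∫ ω, (c * s k ω) ^ 4 ∂P) * (∫ w, w ^ 4 ∂ν - 1) =
      n (m + 1) * (c ^ 4 * (∫ ω, s 0 ω ^ 4 ∂P) * (∫ w, w ^ 4 ∂ν - 1)) := by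
    have : ∀ k, ∫ ω, (c * s k ω) ^ 4 ∂P = c ^ 4 * ∫ ω, s 0 ω ^ 4 ∂P := by
      intro k
      simp only [mul_pow, integral_const_mul]
      congr 1
      exact ((hid k).comp (u := fun t : ℝ => t ^ 4) (by fun_prop)).integral_eq
    simp only [this, Finset.sum_const, Finset.card_univ, Fintype.card_fin, nsmul_eq_mul]
  have hsum3 : ∑ k, (∫ ω, |c * s k ω| ^ 3 ∂P) * ∫ w, |w| ^ 3 ∂ν =
      n (m + 1) * (c ^ 3 * (∫ ω, |s 0 ω| ^ 3 ∂P) * ∫ w, |w| ^ 3 ∂ν) := by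
    have : ∀ k, ∫ ω, |c * s k ω| ^ 3 ∂P = c ^ 3 * ∫ ω, |s 0 ω| ^ 3 ∂P := by
      intro k
      simp only [abs_mul, mul_pow, integral_const_mul]
      rw [abs_of_nonneg (by positivity)]
      congr 1
      exact ((hid k).comp (u := fun t : ℝ => |t| ^ 3) (by fun_prop)).integral_eq
    simp only [this, Finset.sum_const, Finset.card_univ, Fintype.card_fin, nsmul_eq_mul]
  have hfluc : ∫ ω, (K - Cb - ∑ k, (c * s k ω) ^ 2) ^ 2 ∂P =
      fluctuation P σ Cb CW n W b x 2 (m + 1) := by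
    have hc2 : c ^ 2 = CW / n (m + 1) := by
      rw [hc, div_pow, Real.sq_sqrt hCW.le, Real.sq_sqrt hN.le]
    simp only [fluctuation, mul_pow, hc2, sq_abs, ← hKdef]
    congr with ω
    ring
  have hle := hsetup.wassersteinOne_le hCb hK0
  rw [hsum4, hsum3, hfluc] at hle
  rw [hV]
  refine hle.trans (ENNReal.ofReal_le_ofReal ?_)
  exact network_constants_le hCW hN hK0 hm1 (integral_nonneg fun ω => by positivity)
    (integral_abs_pow_three_le hν4)
    (integral_abs_pow_three_le hs0) (integral_nonneg fun ω => by positivity)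

end NetworkBound

end

theorem mainTheorem7 {Ω : Type*} [MeasurableSpace Ω] (P : Measure Ω) [IsProbabilityMeasure P]
    (Cb : ℝ) (hCb : 0 ≤ Cb) :
    -- the network bound
    (∀ (CW : ℝ), 0 < CW → ∀ (σ : ℝ → ℝ), Measurable σ →
      ∀ (L : ℕ), 1 ≤ L → ∀ (n : ℕ → ℕ) [∀ ℓ, NeZero (n ℓ)]
        (W : (ℓ : ℕ) → Fin (n (ℓ + 1)) → Fin (n ℓ) → Ω → ℝ)
        (b : (ℓ : ℕ) → Fin (n (ℓ + 1)) → Ω → ℝ) (ν : Measure ℝ) (x : Fin (n 0) → ℝ),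
      IsRandomInit P L n Cb ν W b →
      Integrable (fun w : ℝ => w ^ 4) ν →
      Integrable (fun ω => |σ (preact σ CW n W b x L 0 ω)| ^ 4) P →
      ∀ (K : ℝ), K = limitVar P σ Cb CW n W b x (L + 1) → K ≠ 0 →
      wassersteinOne (P.map (preact σ CW n W b x (L + 1) 0)) (gaussianReal 0 K.toNNReal) ≤
        ENNReal.ofReal
          (CW / (√(n L) * √K) * (∫ w, w ^ 4 ∂ν) ^ (3 / 4 : ℝ)
              * ((∫ ω, |σ (preact σ CW n W b x L 0 ω)| ^ 4 ∂P) ^ (3 / 4 : ℝ) + 1)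
              * (4 * √CW / √K + 1 / √(2 * Real.pi))
            + √(2 / (K * Real.pi)) * √(fluctuation P σ Cb CW n W b x 2 L))) ∧
    -- the normal approximation bound for a function of independent variables plus a Gaussian bias
    (∀ {E : Type*} [TopologicalSpace E] [PolishSpace E] [MeasurableSpace E] [BorelSpace E]
        (k : ℕ) (f : (Fin k → E) → ℝ) (X X' : Fin k → Ω → E) (b : Ω → ℝ) (K : ℝ),
      Measurable f → (∀ i, Measurable (X i)) → (∀ i, Measurable (X' i)) → Measurable b →
      0 < K →
      P.map b = gaussianReal 0 Cb.toNNReal →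
      -- `X` has independent entries, `X'` is an independent copy of it, and `b` is independent of both
      iIndepFun X P →
      P.map (fun ω i => X' i ω) = P.map (fun ω i => X i ω) →
      IndepFun (fun ω i => X i ω) (fun ω i => X' i ω) P →
      IndepFun b (fun ω => ((fun i => X i ω), (fun i => X' i ω))) P →
      Integrable (fun ω => f (fun i => X i ω) ^ 4) P →
      ∫ ω, f (fun i => X i ω) ∂P = 0 →
      ∀ (V : Ω → ℝ), V = (fun ω => b ω + f (fun i => X i ω)) →
      wassersteinOne (P.map V) (gaussianReal 0 K.toNNReal) ≤
        ENNReal.ofReal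
          (√(2 / (K * Real.pi)) *
              √(∫ ω, (P[fun ω' => K - Cb - steinT f (fun i => X i ω') (fun i => X' i ω')
                  | MeasurableSpace.comap V inferInstance]) ω ^ 2 ∂P)
            + 1 / (2 * K) * ∑ j, ∫ ω,
                |discreteDiff f (fun i => X' i ω) j (fun i => X i ω)| ^ 3 ∂P)) := by
  refine ⟨fun CW hCW σ hσ L hL n _ W b ν x h h4 hσ4 K hKdef hK => ?_,
    fun {E} _ _ _ _ k f X X' b K hf hX hX' hb hK hblaw hind hlaw hXX' hbX hL hmean V hV =>
      wassersteinOne_bias_add_le hCb hf hX hX' hb hK hblaw hind hlaw hXX' hbX hL hmean hV⟩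
  obtain ⟨m, rfl⟩ := Nat.exists_eq_add_of_le' hL
  subst hKdef
  exact wassersteinOne_preact_le hCb hCW hσ h h4 hσ4 hK
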